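/- Let $\mathbf A$ be a symmetric polycategory: it has objects, poly-hom-sets $\mathbf A(\Gamma;\Delta)$ whose domain $\Gamma$ and codomain $\Delta$ are finite families of objects indexed by named channels, an action of renamings of channels, identities $1_x$, and a composition (cut) of $f$ and $g$ along one codomain channel of $f$ and one domain channel of $g$ carrying the same object; these satisfy the usual unit, associativity, interchange and equivariance laws. **The polycategory $\Sigma\Pi_{\mathbf A}$.** Its objects are the formulas generated from the objects of $\mathbf A$ (atoms) by finite, possibly empty, sums $\sum_{i\in I}X_i$ and products $\prod_{i\in I}X_i$. For finite families $\Gamma,\Delta$ of formulas on named channels, $\mathrm{Hom}(\Gamma;\Delta)$ is the set of derivations of $\Gamma\vdash\Delta$ modulo $\sim$. Derivations are built from the following rules. * Axioms: the morphisms of $\mathbf A$ between families of atoms; the identity axiom on $x$ is $1_x$. * Cotupling on a domain channel carrying $\sum_{i\in I} X_i$, and tupling on a codomain channel carrying $\prod_{i\in I} X_i$: from derivations of the sequents with that formula replaced by $X_i$, one for each $i\in I$. * Projection on a domain channel $\alpha$ carrying $\prod_{i\in I} X_i$, and injection on a codomain channel $\alpha$ carrying $\sum_{i\in I} X_i$: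 from a derivation $f$ of the sequent with that formula replaced by $X_k$, for some $k\in I$; the result is written $\overline{\alpha}[k](f)$. * Cut: from derivations of $\Gamma_1\vdash\Delta_1,Z$ and $Z,\Gamma_2\vdash\Delta_2$, a derivation of $\Gamma_1,\Gamma_2\vdash\Delta_1,\Delta_2$. The relation $\sim$ is the congruence generated by: * a cut of two axioms equals the axiom given by their composite in $\mathbf A$; $f;1\sim f$ and $1;f\sim f$ (up to renaming the cut channel); * a cut commutes with a cotupling, tupling, projection or injection that is the last rule of one of its premises and acts on a channel other than the cut channel; * a cut, on a sum or product, of the $k$-th injection of $f$ with the cotupling of $(g_i)_{i\in I}$ equals the cut of $f$ with $g_k$, and a cut of the tupling of $(f_i)_{i\in I}$ with the $k$-th projection of $g$ equals the cut of $f_k$ with $g$; * any two of the rules cotupling, tupling, projection, injection that act on two different channels commute with each other (including the cases with an empty index set). The inclusion $\mathcal I:\mathbf A\to\Sigma\Pi_{\mathbf A}$ sends an object to the corresponding atom and a morphism to the class of the corresponding axiom. Each $\overline\alpha[k]$ is well defined on classes. **Softness.** The *output index* $\mathrm{oi}(\Gamma;\Delta)$ is the set of pairs $(\alpha,i)$ where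 $\alpha$ is a channel carrying an output formula, that is, a product $\prod_{i\in I}X_i$ in $\Gamma$ or a sum $\sum_{i\in I}X_i$ in $\Delta$, and $i\in I$. For $(\alpha,i)\in\mathrm{oi}(\Gamma;\Delta)$ let $[\mathrm{Hom}(\Gamma;\Delta)]_{(\alpha,i)}$ be the poly-hom-set obtained by replacing the formula on $\alpha$ by its component $X_i$, and for $(\alpha,i),(\beta,j)\in \mathrm{oi}(\Gamma;\Delta)$ with $\alpha\neq\beta$ let $[\mathrm{Hom}(\Gamma;\Delta)]_{((\alpha,i),(\beta,j))}$ be the poly-hom-set obtained by doing both replacements. Call $\mathrm{Hom}(\Gamma;\Delta)$ an *output poly-hom-set* if every formula in $\Gamma$ is an atom or a product, every formula in $\Delta$ is an atom or a sum, and at least one of them is not an atom. **Lemma.** The inclusion $\mathcal I:\mathbf A\to\Sigma\Pi_{\mathbf A}$ is soft, that is, for every output poly-hom-set $\mathrm{Hom}(\Gamma;\Delta)$ of $\Sigma\Pi_{\mathbf A}$: 1. (*$\mathcal I$ is a semi-soft extension*) the cotupled map $$\{\overline{\alpha}[i](\_)\}_{(\alpha,i)}:\sum_{(\alpha,i)\in\mathrm{oi}(\Gamma;\Delta)}[\mathrm{Hom}(\Gamma;\Delta)]_{(\alpha,i)}\longrightarrow\mathrm{Hom}(\Gamma;\Delta)$$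 is surjective, i.e. every morphism in $\mathrm{Hom}(\Gamma;\Delta)$ is of the form $\overline{\alpha}[i](f)$, a projection or an injection; 2. (*$\mathcal I$ is a soft extension*) the diagram $$\sum_{\substack{(\alpha,i),(\beta,j)\in\mathrm{oi}(\Gamma;\Delta)\\ \alpha\ne\beta}}[\mathrm{Hom}(\Gamma;\Delta)]_{((\alpha,i),(\beta,j))}\;\rightrightarrows\;\sum_{(\gamma,k)\in\mathrm{oi}(\Gamma;\Delta)}[\mathrm{Hom}(\Gamma;\Delta)]_{(\gamma,k)}\;\xrightarrow{\{\overline\gamma[k](\_)\}_{(\gamma,k)}}\;\mathrm{Hom}(\Gamma;\Delta)$$ is a coequalizer diagram in $\mathbf{Set}$, where on the summand of $((\alpha,i),(\beta,j))$ one of the parallel maps is $\overline\beta[j](\_)$ into the summand $(\alpha,i)$ and the other is $\overline\alpha[i](\_)$ into the summand $(\beta,j)$. -/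

import Mathlib

universe u v

namespace SigmaPi

/-! ### Polycategories

A polymorphism has a finite set `C` of input channels and a finite set `D` of output channels,
each carrying an object.  Channels are referred to by name, so that a list of `m` objects is the
case `C = Fin m`, and permuting or renaming channels is an action of bijections. -/

/-- `Option C ⊕ C' ≃ Option (C ⊕ C')`, keeping the distinguished channel `none`. -/
def optL (C C' : Type) : Option C ⊕ C' ≃ Option (C ⊕ C') where
  toFun x := x.elim (fun o => o.map Sum.inl) (fun c => some (Sum.inr c))
  invFun o := o.elim (Sum.inl none) (fun x => x.elim (fun c => Sum.inl (some c)) Sum.inr)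
  left_inv := by rintro ((_ | _) | _) <;> rfl
  right_inv := by rintro (_ | (_ | _)) <;> rfl

/-- `C ⊕ Option C' ≃ Option (C ⊕ C')`, keeping the distinguished channel `none`. -/
def optR (C C' : Type) : C ⊕ Option C' ≃ Option (C ⊕ C') where
  toFun x := x.elim (fun c => some (Sum.inl c)) (fun o => o.map Sum.inr)
  invFun o := o.elim (Sum.inr none) (fun x => x.elim Sum.inl (fun c => Sum.inr (some c)))
  left_inv := by rintro (_ | (_ | _)) <;> rfl
  right_inv := by rintro (_ | (_ | _)) <;> rfl

/-- Exchange the two distinguished channels of `Option (Option C)`. -/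
def optSwap (C : Type) : Option (Option C) ≃ Option (Option C) where
  toFun o := o.elim (some none) (fun o' => o'.elim none (fun c => some (some c)))
  invFun o := o.elim (some none) (fun o' => o'.elim none (fun c => some (some c)))
  left_inv := by rintro (_ | (_ | _)) <;> rfl
  right_inv := by rintro (_ | (_ | _)) <;> rfl

/-- `(C ⊕ C') ⊕ C'' ≃ (C ⊕ C'') ⊕ C'`. -/
def sumSwapRight (C C' C'' : Type) : (C ⊕ C') ⊕ C'' ≃ (C ⊕ C'') ⊕ C' where
  toFun x := x.elim (fun y => y.elim (fun c => .inl (.inl c)) .inr) (fun c => .inl (.inr c))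
  invFun x := x.elim (fun y => y.elim (fun c => .inl (.inl c)) .inr) (fun c => .inl (.inr c))
  left_inv := by rintro ((_ | _) | _) <;> rfl
  right_inv := by rintro ((_ | _) | _) <;> rfl

/-- `C ⊕ (C' ⊕ C'') ≃ C' ⊕ (C ⊕ C'')`. -/
def sumSwapLeft (C C' C'' : Type) : C ⊕ (C' ⊕ C'') ≃ C' ⊕ (C ⊕ C'') where
  toFun x := x.elim (fun c => .inr (.inl c)) (fun y => y.elim .inl (fun c => .inr (.inr c)))
  invFun x := x.elim (fun c => .inr (.inl c)) (fun y => y.elim .inl (fun c => .inr (.inr c)))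
  left_inv := by rintro (_ | (_ | _)) <;> rfl
  right_inv := by rintro (_ | (_ | _)) <;> rfl

/-- Symmetric polycategories.  `Hom a b` is the poly-hom-set with inputs `a` and outputs `b`;
`rename` is the symmetric action (change of channel names).  `cut h f g` composes `f` and `g`
along the output channel `none` of `f` and the input channel `none` of `g`. -/
structure Polycategory where
  Obj : Type u
  Hom : {C D : Type} → [Finite C] → [Finite D] → (C → Obj) → (D → Obj) → Type v
  rename : {C D C' D' : Type} → [Finite C] → [Finite D] → [Finite C'] → [Finite D'] →
    {a : C → Obj} → {b : D → Obj} → {a' : C' → Obj} → {b' : D' → Obj} →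
    (e : C ≃ C') → (e' : D ≃ D') → (∀ c, a' (e c) = a c) → (∀ d, b' (e' d) = b d) →
    Hom a b → Hom a' b'
  id : (x : Obj) → Hom (fun _ : Unit => x) (fun _ : Unit => x)
  cut : {C D C' D' : Type} → [Finite C] → [Finite D] → [Finite C'] → [Finite D'] →
    {a : C → Obj} → {b : Option D → Obj} → {a' : Option C' → Obj} → {b' : D' → Obj} →
    b none = a' none → Hom a b → Hom a' b' →
    Hom (Sum.elim a fun c => a' (some c)) (Sum.elim (fun d => b (some d)) b')
  /-- The action is functorial. -/
  rename_refl : ∀ {C D : Type} [Finite C] [Finite D] {a : C → Obj} {b : D → Obj} (f : Hom a b),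
    rename (Equiv.refl C) (Equiv.refl D) (fun _ => rfl) (fun _ => rfl) f = f
  rename_trans : ∀ {C D C' D' C'' D'' : Type} [Finite C] [Finite D] [Finite C'] [Finite D']
    [Finite C''] [Finite D''] {a : C → Obj} {b : D → Obj} {a' : C' → Obj} {b' : D' → Obj}
    {a'' : C'' → Obj} {b'' : D'' → Obj} (e : C ≃ C') (e' : D ≃ D') (k : C' ≃ C'') (k' : D' ≃ D'')
    (ha : ∀ c, a' (e c) = a c) (hb : ∀ d, b' (e' d) = b d)
    (ha' : ∀ c, a'' (k c) = a' c) (hb' : ∀ d, b'' (k' d) = b' d) (f : Hom a b),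
    rename k k' ha' hb' (rename e e' ha hb f) =
      rename (e.trans k) (e'.trans k') (fun c => (ha' (e c)).trans (ha c))
        (fun d => (hb' (e' d)).trans (hb d)) f
  /-- Cutting is compatible with the action. -/
  cut_rename : ∀ {C D C' D' E F E' F' : Type} [Finite C] [Finite D] [Finite C'] [Finite D']
    [Finite E] [Finite F] [Finite E'] [Finite F']
    {a : C → Obj} {b : Option D → Obj} {a' : Option C' → Obj} {b' : D' → Obj}
    {x : E → Obj} {y : Option F → Obj} {x' : Option E' → Obj} {y' : F' → Obj}
    (e : C ≃ E) (e' : D ≃ F) (k : C' ≃ E') (k' : D' ≃ F')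
    (hx : ∀ c, x (e c) = a c) (hy : ∀ d, y (e'.optionCongr d) = b d)
    (hx' : ∀ c, x' (k.optionCongr c) = a' c) (hy' : ∀ d, y' (k' d) = b' d)
    (h : b none = a' none) (f : Hom a b) (g : Hom a' b'),
    cut ((hy none).trans (h.trans (hx' none).symm))
        (rename e e'.optionCongr hx hy f) (rename k.optionCongr k' hx' hy' g) =
      rename (e.sumCongr k) (e'.sumCongr k')
        (by rintro (c | c); exacts [hx c, hx' (some c)])
        (by rintro (d | d); exacts [hy (some d), hy' d]) (cut h f g)
  /-- Identities are neutral for cut, on both sides. -/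
  cut_id : ∀ {C D : Type} [Finite C] [Finite D] {a : C → Obj} {b : Option D → Obj}
    (f : Hom a b),
    cut (a' := fun _ : Option Empty => b none) (b' := fun _ : Unit => b none) rfl f
        (rename (C' := Option Empty) (Equiv.ofUnique Unit (Option Empty)) (Equiv.refl Unit)
          (fun _ => rfl) (fun _ => rfl) (id (b none))) =
      rename (Equiv.sumEmpty C Empty).symm (Equiv.optionEquivSumPUnit.{0, 0} D)
        (fun _ => rfl) (by rintro (_ | _) <;> rfl) f
  id_cut : ∀ {C D : Type} [Finite C] [Finite D] {a : Option C → Obj} {b : D → Obj}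
    (f : Hom a b),
    cut (a := fun _ : Unit => a none) (b := fun _ : Option Empty => a none) rfl
        (rename (D' := Option Empty) (Equiv.refl Unit) (Equiv.ofUnique Unit (Option Empty))
          (fun _ => rfl) (fun _ => rfl) (id (a none))) f =
      rename ((Equiv.optionEquivSumPUnit.{0, 0} C).trans (Equiv.sumComm C Unit))
        (Equiv.emptySum Empty D).symm (by rintro (_ | _) <;> rfl) (fun _ => rfl) f
  /-- Associativity of cut. -/
  cut_assoc : ∀ {C D C' D' C'' D'' : Type} [Finite C] [Finite D] [Finite C'] [Finite D']
    [Finite C''] [Finite D''] {a : C → Obj} {b : Option D → Obj}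
    {a' : Option C' → Obj} {b' : Option D' → Obj} {a'' : Option C'' → Obj} {b'' : D'' → Obj}
    (h : b none = a' none) (h' : b' none = a'' none)
    (f : Hom a b) (g : Hom a' b') (k : Hom a'' b''),
    rename (Equiv.sumAssoc C C' C'') (Equiv.sumAssoc D D' D'')
        (by rintro ((_ | _) | _) <;> rfl) (by rintro ((_ | _) | _) <;> rfl)
        (cut (b := fun o => o.elim (b' none) (Sum.elim (fun d => b (some d)) fun d => b' (some d)))
          h' (rename (Equiv.refl _) (optR D D') (fun _ => rfl)
            (by rintro (_ | (_ | _)) <;> rfl) (cut h f g)) k) =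
      cut (a' := fun o => o.elim (a' none) (Sum.elim (fun c => a' (some c)) fun c => a'' (some c)))
        h f (rename (optL C' C'') (Equiv.refl _)
          (by rintro ((_ | _) | _) <;> rfl) (fun _ => rfl) (cut h' g k))
  /-- Interchange: two cuts on different outputs of `f` commute. -/
  interchange_out : ∀ {C D C' D' C'' D'' : Type} [Finite C] [Finite D] [Finite C'] [Finite D']
    [Finite C''] [Finite D''] {a : C → Obj} {b : Option (Option D) → Obj}
    {a' : Option C' → Obj} {b' : D' → Obj} {a'' : Option C'' → Obj} {b'' : D'' → Obj}
    (h : b none = a' none) (h' : b (some none) = a'' none)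
    (f : Hom a b) (g : Hom a' b') (k : Hom a'' b''),
    rename (sumSwapRight C C' C'') (sumSwapRight D D' D'')
        (by rintro ((_ | _) | _) <;> rfl) (by rintro ((_ | _) | _) <;> rfl)
        (cut (b := fun o => o.elim (b (some none)) (Sum.elim (fun d => b (some (some d))) b'))
          h' (rename (Equiv.refl _) (optL D D') (fun _ => rfl)
            (by rintro ((_ | _) | _) <;> rfl) (cut h f g)) k) =
      cut (b := fun o => o.elim (b none) (Sum.elim (fun d => b (some (some d))) b''))
        h (rename (Equiv.refl _) (optL D D'') (fun _ => rfl)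
          (by rintro ((_ | _) | _) <;> rfl)
          (cut (b := fun o => b (optSwap D o)) h'
            (rename (Equiv.refl _) (optSwap D) (fun _ => rfl)
              (by rintro (_ | (_ | _)) <;> rfl) f) k)) g
  /-- Interchange: two cuts on different inputs of `k` commute. -/
  interchange_in : ∀ {C D C' D' C'' D'' : Type} [Finite C] [Finite D] [Finite C'] [Finite D']
    [Finite C''] [Finite D''] {a : C → Obj} {b : Option D → Obj}
    {a' : C' → Obj} {b' : Option D' → Obj} {a'' : Option (Option C'') → Obj} {b'' : D'' → Obj}
    (h : b none = a'' none) (h' : b' none = a'' (some none))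
    (f : Hom a b) (g : Hom a' b') (k : Hom a'' b''),
    rename (sumSwapLeft C C' C'') (sumSwapLeft D D' D'')
        (by rintro (_ | (_ | _)) <;> rfl) (by rintro (_ | (_ | _)) <;> rfl)
        (cut (a' := fun o => o.elim (a'' none) (Sum.elim a' fun c => a'' (some (some c))))
          h f (rename (optR C' C'') (Equiv.refl _)
            (by rintro (_ | (_ | _)) <;> rfl) (fun _ => rfl)
            (cut (a' := fun o => a'' (optSwap C'' o)) h' g
              (rename (optSwap C'') (Equiv.refl _)
                (by rintro (_ | (_ | _)) <;> rfl) (fun _ => rfl) k)))) =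
      cut (a' := fun o => o.elim (a'' (some none)) (Sum.elim a fun c => a'' (some (some c))))
        h' g (rename (optR C C'') (Equiv.refl _)
          (by rintro (_ | (_ | _)) <;> rfl) (fun _ => rfl) (cut h f k))

/-! ### Formulas and sequents -/

/-- Formulas over a class of atoms: atoms, and finite (possibly empty) sums and products. -/
inductive Form (O : Type u) : Type (max 1 u)
  | atom (x : O) : Form O
  | sum {I : Type} [Finite I] (X : I → Form O) : Form O
  | prod {I : Type} [Finite I] (X : I → Form O) : Form O

/-- A sequent `Γ ⊢ Δ` with domain channels `C` and codomain channels `D`: `Γ` is the restriction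
to the channels `Sum.inl c`, and `Δ` the restriction to the channels `Sum.inr d`. -/
abbrev Sequent (O : Type u) (C D : Type) := C ⊕ D → Form O

variable {O : Type u} {C D : Type}

/-- The compound formula on which the channel `α` inputs: a sum in the domain, a product in the
codomain. -/
def inForm (α : C ⊕ D) {I : Type} [Finite I] (X : I → Form O) : Form O :=
  α.elim (fun _ => .sum X) (fun _ => .prod X)

/-- The compound formula on which the channel `α` outputs: a product in the domain, a sum in the
codomain. -/
def outForm (α : C ⊕ D) {I : Type} [Finite I] (X : I → Form O) : Form O :=
  α.elim (fun _ => .prod X) (fun _ => .sum X)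

open scoped Classical in
/-- Replace the formula on channel `α` by `X`. -/
noncomputable def repl (Φ : Sequent O C D) (α : C ⊕ D) (X : Form O) : Sequent O C D :=
  Function.update Φ α X

theorem repl_of_ne {Φ : Sequent O C D} {α β : C ⊕ D} (h : β ≠ α) (X : Form O) :
    repl Φ α X β = Φ β := by
  classical exact Function.update_of_ne h X Φ

theorem repl_comm {Φ : Sequent O C D} {α β : C ⊕ D} (h : α ≠ β) (X Y : Form O) :
    repl (repl Φ α X) β Y = repl (repl Φ β Y) α X := by
  classical exact Function.update_comm h X Y Φ

/-- A cut with conclusion `Φ` distributes the channels of `Φ` over its premises: those in `p` and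
`q` go to the left premise, the others to the right one.  The left premise has the cut formula `Z`
on one more codomain channel, `none`. -/
def cutLeft (p : Set C) (q : Set D) (Z : Form O) (Φ : Sequent O C D) : Sequent O p (Option q) :=
  Sum.elim (fun c => Φ (.inl c)) (fun o => o.elim Z fun d => Φ (.inr d))

/-- The right premise of a cut has the cut formula `Z` on one more domain channel, `none`. -/
def cutRight (p : Set C) (q : Set D) (Z : Form O) (Φ : Sequent O C D) :
    Sequent O (Option ↥pᶜ) ↥qᶜ :=
  Sum.elim (fun o => o.elim Z fun c => Φ (.inl c)) (fun d => Φ (.inr d))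

/-! ### Derivations -/

/-- Derivations.  The premises are allowed to be any sequents equal to the expected ones.
* `ax`: the axioms are the morphisms of `A` (the identity axioms are the identities of `A`);
* `inp`: cotupling (`α` in the domain) and tupling (`α` in the codomain);
* `out`: projection (`α` in the domain) and injection (`α` in the codomain);
* `cut`. -/
inductive Deriv (A : Polycategory.{u, v}) :
    {C D : Type} → Sequent A.Obj C D → Type (max 1 u v)
  | ax {C D : Type} [Finite C] [Finite D] {Φ : Sequent A.Obj C D} {a : C → A.Obj} {b : D → A.Obj}
      (ha : ∀ c, Φ (.inl c) = .atom (a c)) (hb : ∀ d, Φ (.inr d) = .atom (b d))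
      (f : A.Hom a b) : Deriv A Φ
  | inp {C D : Type} {Φ : Sequent A.Obj C D} (α : C ⊕ D) {I : Type} [Finite I]
      (X : I → Form A.Obj) (hα : Φ α = inForm α X) {Ψ : I → Sequent A.Obj C D}
      (hΨ : ∀ i, Ψ i = repl Φ α (X i)) (f : ∀ i, Deriv A (Ψ i)) : Deriv A Φ
  | out {C D : Type} {Φ : Sequent A.Obj C D} (α : C ⊕ D) {I : Type} [Finite I]
      (X : I → Form A.Obj) (hα : Φ α = outForm α X) (k : I) {Ψ : Sequent A.Obj C D}
      (hΨ : Ψ = repl Φ α (X k)) (f : Deriv A Ψ) : Deriv A Φ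
  | cut {C D : Type} {Φ : Sequent A.Obj C D} (p : Set C) (q : Set D) (Z : Form A.Obj)
      {Ψ₁ : Sequent A.Obj p (Option q)} {Ψ₂ : Sequent A.Obj (Option ↥pᶜ) ↥qᶜ}
      (h₁ : Ψ₁ = cutLeft p q Z Φ) (h₂ : Ψ₂ = cutRight p q Z Φ)
      (f : Deriv A Ψ₁) (g : Deriv A Ψ₂) : Deriv A Φ

variable {A : Polycategory.{u, v}}

/-- Renaming of channels in derivations. -/
noncomputable def Deriv.rename : {C D : Type} → {Φ : Sequent A.Obj C D} → Deriv A Φ →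
    {C' D' : Type} → {Φ' : Sequent A.Obj C' D'} → (e : C ≃ C') → (e' : D ≃ D') →
    (∀ x, Φ' (Sum.map e e' x) = Φ x) → Deriv A Φ'
  | _, _, _, @Deriv.ax _ C D _ _ _ a b ha hb f, _, _, _, e, e', h =>
      haveI := Finite.of_equiv _ e
      haveI := Finite.of_equiv _ e'
      .ax (a := fun c => a (e.symm c)) (b := fun d => b (e'.symm d))
        (fun c => by have := h (.inl (e.symm c)); simp_all)
        (fun d => by have := h (.inr (e'.symm d)); simp_all)
        (A.rename e e' (by simp) (by simp) f)
  | _, _, _, @Deriv.inp _ _ _ _ α I _ X hα _ hΨ f, _, _, Φ', e, e', h =>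
      .inp (Sum.map e e' α) X (by rw [h, hα]; cases α <;> rfl)
        (Ψ := fun i => repl Φ' (Sum.map e e' α) (X i)) (fun _ => rfl)
        (fun i => (f i).rename e e' (by
          intro x
          rw [hΨ i]
          by_cases hx : x = α
          · subst hx; simp [repl]
          · rw [repl_of_ne hx, repl_of_ne, h]
            exact fun hh => hx ((e.sumCongr e').injective hh)))
  | _, _, _, @Deriv.out _ _ _ _ α I _ X hα k _ hΨ f, _, _, Φ', e, e', h =>
      .out (Sum.map e e' α) X (by rw [h, hα]; cases α <;> rfl) k
        (Ψ := repl Φ' (Sum.map e e' α) (X k)) rfl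
        (f.rename e e' (by
          intro x
          rw [hΨ]
          by_cases hx : x = α
          · subst hx; simp [repl]
          · rw [repl_of_ne hx, repl_of_ne, h]
            exact fun hh => hx ((e.sumCongr e').injective hh)))
  | _, _, _, .cut p q Z h₁ h₂ f g, _, _, Φ', e, e', h =>
      .cut (e.symm ⁻¹' p) (e'.symm ⁻¹' q) Z rfl rfl
        (f.rename (e.subtypeEquiv (by simp)) (e'.subtypeEquiv (by simp)).optionCongr (by
          subst h₁
          rintro (c | _ | d)
          exacts [h (.inl c), rfl, h (.inr d)]))
        (g.rename (e.subtypeEquiv (by simp)).optionCongr (e'.subtypeEquiv (by simp)) (by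
          subst h₂
          rintro ((_ | c) | d)
          exacts [rfl, h (.inl c), h (.inr d)]))

open scoped Classical in
/-- The equivalence `∼` of derivations of a sequent: the congruence generated by the
cut-elimination rewrites and the permuting conversions. -/
inductive Conv {A : Polycategory.{u, v}} :
    {C D : Type} → {Φ : Sequent A.Obj C D} → Deriv A Φ → Deriv A Φ → Prop
  -- equivalence relation
  | refl {C D : Type} {Φ : Sequent A.Obj C D} (f : Deriv A Φ) : Conv f f
  | symm {C D : Type} {Φ : Sequent A.Obj C D} {f g : Deriv A Φ} : Conv f g → Conv g f
  | trans {C D : Type} {Φ : Sequent A.Obj C D} {f g h : Deriv A Φ} :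
      Conv f g → Conv g h → Conv f h
  -- congruence
  | inp_congr {C D : Type} {Φ : Sequent A.Obj C D} {α : C ⊕ D} {I : Type} [Finite I]
      {X : I → Form A.Obj} {hα : Φ α = inForm α X} {Ψ : I → Sequent A.Obj C D}
      {hΨ : ∀ i, Ψ i = repl Φ α (X i)} {f g : ∀ i, Deriv A (Ψ i)} :
      (∀ i, Conv (f i) (g i)) → Conv (.inp α X hα hΨ f) (.inp α X hα hΨ g)
  | out_congr {C D : Type} {Φ : Sequent A.Obj C D} {α : C ⊕ D} {I : Type} [Finite I]
      {X : I → Form A.Obj} {hα : Φ α = outForm α X} {k : I} {Ψ : Sequent A.Obj C D}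
      {hΨ : Ψ = repl Φ α (X k)} {f g : Deriv A Ψ} :
      Conv f g → Conv (.out α X hα k hΨ f) (.out α X hα k hΨ g)
  | cut_congr {C D : Type} {Φ : Sequent A.Obj C D} {p : Set C} {q : Set D} {Z : Form A.Obj}
      {Ψ₁ : Sequent A.Obj p (Option q)} {Ψ₂ : Sequent A.Obj (Option ↥pᶜ) ↥qᶜ}
      {h₁ : Ψ₁ = cutLeft p q Z Φ} {h₂ : Ψ₂ = cutRight p q Z Φ}
      {f f' : Deriv A Ψ₁} {g g' : Deriv A Ψ₂} :
      Conv f f' → Conv g g' → Conv (.cut p q Z h₁ h₂ f g) (.cut p q Z h₁ h₂ f' g')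
  -- a cut between axioms is the composite in `A`
  | cut_ax {C D : Type} [Finite C] [Finite D] {Φ : Sequent A.Obj C D} {p : Set C} {q : Set D}
      {Z : Form A.Obj}
      {Ψ₁ : Sequent A.Obj p (Option q)} {Ψ₂ : Sequent A.Obj (Option ↥pᶜ) ↥qᶜ}
      {h₁ : Ψ₁ = cutLeft p q Z Φ} {h₂ : Ψ₂ = cutRight p q Z Φ}
      {a₁ : p → A.Obj} {b₁ : Option q → A.Obj} {a₂ : Option ↥pᶜ → A.Obj} {b₂ : ↥qᶜ → A.Obj}
      {ha₁ : ∀ c, Ψ₁ (.inl c) = .atom (a₁ c)} {hb₁ : ∀ d, Ψ₁ (.inr d) = .atom (b₁ d)}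
      {ha₂ : ∀ c, Ψ₂ (.inl c) = .atom (a₂ c)} {hb₂ : ∀ d, Ψ₂ (.inr d) = .atom (b₂ d)}
      {a : C → A.Obj} {b : D → A.Obj}
      {ha : ∀ c, Φ (.inl c) = .atom (a c)} {hb : ∀ d, Φ (.inr d) = .atom (b d)}
      (h : b₁ none = a₂ none)
      (ha' : ∀ c, a (Equiv.Set.sumCompl p c) = Sum.elim a₁ (fun c => a₂ (some c)) c)
      (hb' : ∀ d, b (Equiv.Set.sumCompl q d) = Sum.elim (fun d => b₁ (some d)) b₂ d)
      (f : A.Hom a₁ b₁) (g : A.Hom a₂ b₂) :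
      Conv (.cut p q Z h₁ h₂ (.ax ha₁ hb₁ f) (.ax ha₂ hb₂ g))
        (.ax ha hb (A.rename (Equiv.Set.sumCompl p) (Equiv.Set.sumCompl q) ha' hb' (A.cut h f g)))
  -- `f ; 1 ⇒ f`: the right premise is an identity axiom, and the cut channel of `f` is renamed
  -- to the codomain channel of that axiom
  | cut_id {C D : Type} [Finite C] [Finite D] {Φ : Sequent A.Obj C D} {p : Set C} {q : Set D}
      {Z : Form A.Obj}
      {Ψ₁ : Sequent A.Obj p (Option q)} {Ψ₂ : Sequent A.Obj (Option ↥pᶜ) ↥qᶜ}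
      {h₁ : Ψ₁ = cutLeft p q Z Φ} {h₂ : Ψ₂ = cutRight p q Z Φ} (x : A.Obj)
      {a : Option ↥pᶜ → A.Obj} {b : ↥qᶜ → A.Obj}
      {ha : ∀ c, Ψ₂ (.inl c) = .atom (a c)} {hb : ∀ d, Ψ₂ (.inr d) = .atom (b d)}
      (u : Unit ≃ Option ↥pᶜ) (w : Unit ≃ ↥qᶜ) (hu : ∀ t, a (u t) = x) (hw : ∀ t, b (w t) = x)
      (e : p ≃ C) (he : ∀ c : p, e c = c) (e' : Option q ≃ D) (he' : ∀ d : q, e' (some d) = d)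
      (hΦ : ∀ y, Φ (Sum.map e e' y) = Ψ₁ y) (f : Deriv A Ψ₁) :
      Conv (.cut p q Z h₁ h₂ f (.ax ha hb (A.rename u w hu hw (A.id x)))) (f.rename e e' hΦ)
  -- `1 ; g ⇒ g`
  | id_cut {C D : Type} [Finite C] [Finite D] {Φ : Sequent A.Obj C D} {p : Set C} {q : Set D}
      {Z : Form A.Obj}
      {Ψ₁ : Sequent A.Obj p (Option q)} {Ψ₂ : Sequent A.Obj (Option ↥pᶜ) ↥qᶜ}
      {h₁ : Ψ₁ = cutLeft p q Z Φ} {h₂ : Ψ₂ = cutRight p q Z Φ} (x : A.Obj)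
      {a : p → A.Obj} {b : Option q → A.Obj}
      {ha : ∀ c, Ψ₁ (.inl c) = .atom (a c)} {hb : ∀ d, Ψ₁ (.inr d) = .atom (b d)}
      (u : Unit ≃ p) (w : Unit ≃ Option q) (hu : ∀ t, a (u t) = x) (hw : ∀ t, b (w t) = x)
      (e : Option ↥pᶜ ≃ C) (he : ∀ c : ↥pᶜ, e (some c) = c) (e' : ↥qᶜ ≃ D)
      (he' : ∀ d : ↥qᶜ, e' d = d)
      (hΦ : ∀ y, Φ (Sum.map e e' y) = Ψ₂ y) (g : Deriv A Ψ₂) :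
      Conv (.cut p q Z h₁ h₂ (.ax ha hb (A.rename u w hu hw (A.id x))) g) (g.rename e e' hΦ)
  -- a cut moves above a cotupling or tupling in the left premise, not on the cut channel
  | inp_cut {C D : Type} {Φ : Sequent A.Obj C D} {p : Set C} {q : Set D} {Z : Form A.Obj}
      {Ψ₁ : Sequent A.Obj p (Option q)} {Ψ₂ : Sequent A.Obj (Option ↥pᶜ) ↥qᶜ}
      {h₁ : Ψ₁ = cutLeft p q Z Φ} {h₂ : Ψ₂ = cutRight p q Z Φ}
      (α : p ⊕ q) {I : Type} [Finite I] {X : I → Form A.Obj}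
      {hα₁ : Ψ₁ (Sum.map id some α) = inForm (Sum.map id some α) X}
      {Θ₁ : I → Sequent A.Obj p (Option q)} {hΘ₁ : ∀ i, Θ₁ i = repl Ψ₁ (Sum.map id some α) (X i)}
      {hα : Φ (Sum.map Subtype.val Subtype.val α) = inForm (Sum.map Subtype.val Subtype.val α) X}
      {Θ : I → Sequent A.Obj C D}
      {hΘ : ∀ i, Θ i = repl Φ (Sum.map Subtype.val Subtype.val α) (X i)}
      {k₁ : ∀ i, Θ₁ i = cutLeft p q Z (Θ i)} {k₂ : ∀ i, Ψ₂ = cutRight p q Z (Θ i)}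
      (f : ∀ i, Deriv A (Θ₁ i)) (g : Deriv A Ψ₂) :
      Conv (.cut p q Z h₁ h₂ (.inp (Sum.map id some α) X hα₁ hΘ₁ f) g)
        (.inp (Sum.map Subtype.val Subtype.val α) X hα hΘ
          fun i => .cut p q Z (k₁ i) (k₂ i) (f i) g)
  -- a cut moves above a cotupling or tupling in the right premise, not on the cut channel
  | cut_inp {C D : Type} {Φ : Sequent A.Obj C D} {p : Set C} {q : Set D} {Z : Form A.Obj}
      {Ψ₁ : Sequent A.Obj p (Option q)} {Ψ₂ : Sequent A.Obj (Option ↥pᶜ) ↥qᶜ}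
      {h₁ : Ψ₁ = cutLeft p q Z Φ} {h₂ : Ψ₂ = cutRight p q Z Φ}
      (β : ↥pᶜ ⊕ ↥qᶜ) {I : Type} [Finite I] {X : I → Form A.Obj}
      {hβ₂ : Ψ₂ (Sum.map some id β) = inForm (Sum.map some id β) X}
      {Θ₂ : I → Sequent A.Obj (Option ↥pᶜ) ↥qᶜ}
      {hΘ₂ : ∀ i, Θ₂ i = repl Ψ₂ (Sum.map some id β) (X i)}
      {hβ : Φ (Sum.map Subtype.val Subtype.val β) = inForm (Sum.map Subtype.val Subtype.val β) X}
      {Θ : I → Sequent A.Obj C D}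
      {hΘ : ∀ i, Θ i = repl Φ (Sum.map Subtype.val Subtype.val β) (X i)}
      {k₁ : ∀ i, Ψ₁ = cutLeft p q Z (Θ i)} {k₂ : ∀ i, Θ₂ i = cutRight p q Z (Θ i)}
      (f : Deriv A Ψ₁) (g : ∀ i, Deriv A (Θ₂ i)) :
      Conv (.cut p q Z h₁ h₂ f (.inp (Sum.map some id β) X hβ₂ hΘ₂ g))
        (.inp (Sum.map Subtype.val Subtype.val β) X hβ hΘ
          fun i => .cut p q Z (k₁ i) (k₂ i) f (g i))
  -- a cut moves above an injection or projection in the left premise, not on the cut channel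
  | out_cut {C D : Type} {Φ : Sequent A.Obj C D} {p : Set C} {q : Set D} {Z : Form A.Obj}
      {Ψ₁ : Sequent A.Obj p (Option q)} {Ψ₂ : Sequent A.Obj (Option ↥pᶜ) ↥qᶜ}
      {h₁ : Ψ₁ = cutLeft p q Z Φ} {h₂ : Ψ₂ = cutRight p q Z Φ}
      (α : p ⊕ q) {I : Type} [Finite I] {X : I → Form A.Obj}
      {hα₁ : Ψ₁ (Sum.map id some α) = outForm (Sum.map id some α) X} (k : I)
      {Θ₁ : Sequent A.Obj p (Option q)} {hΘ₁ : Θ₁ = repl Ψ₁ (Sum.map id some α) (X k)}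
      {hα : Φ (Sum.map Subtype.val Subtype.val α) = outForm (Sum.map Subtype.val Subtype.val α) X}
      {Θ : Sequent A.Obj C D} {hΘ : Θ = repl Φ (Sum.map Subtype.val Subtype.val α) (X k)}
      {k₁ : Θ₁ = cutLeft p q Z Θ} {k₂ : Ψ₂ = cutRight p q Z Θ}
      (f : Deriv A Θ₁) (g : Deriv A Ψ₂) :
      Conv (.cut p q Z h₁ h₂ (.out (Sum.map id some α) X hα₁ k hΘ₁ f) g)
        (.out (Sum.map Subtype.val Subtype.val α) X hα k hΘ (.cut p q Z k₁ k₂ f g))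
  -- a cut moves above an injection or projection in the right premise, not on the cut channel
  | cut_out {C D : Type} {Φ : Sequent A.Obj C D} {p : Set C} {q : Set D} {Z : Form A.Obj}
      {Ψ₁ : Sequent A.Obj p (Option q)} {Ψ₂ : Sequent A.Obj (Option ↥pᶜ) ↥qᶜ}
      {h₁ : Ψ₁ = cutLeft p q Z Φ} {h₂ : Ψ₂ = cutRight p q Z Φ}
      (β : ↥pᶜ ⊕ ↥qᶜ) {I : Type} [Finite I] {X : I → Form A.Obj}
      {hβ₂ : Ψ₂ (Sum.map some id β) = outForm (Sum.map some id β) X} (k : I)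
      {Θ₂ : Sequent A.Obj (Option ↥pᶜ) ↥qᶜ} {hΘ₂ : Θ₂ = repl Ψ₂ (Sum.map some id β) (X k)}
      {hβ : Φ (Sum.map Subtype.val Subtype.val β) = outForm (Sum.map Subtype.val Subtype.val β) X}
      {Θ : Sequent A.Obj C D} {hΘ : Θ = repl Φ (Sum.map Subtype.val Subtype.val β) (X k)}
      {k₁ : Ψ₁ = cutLeft p q Z Θ} {k₂ : Θ₂ = cutRight p q Z Θ}
      (f : Deriv A Ψ₁) (g : Deriv A Θ₂) :
      Conv (.cut p q Z h₁ h₂ f (.out (Sum.map some id β) X hβ₂ k hΘ₂ g))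
        (.out (Sum.map Subtype.val Subtype.val β) X hβ k hΘ (.cut p q Z k₁ k₂ f g))
  -- an injection on the cut channel meets a cotupling on the cut channel
  | inj_cotuple {C D : Type} {Φ : Sequent A.Obj C D} {p : Set C} {q : Set D} {Z : Form A.Obj}
      {Ψ₁ : Sequent A.Obj p (Option q)} {Ψ₂ : Sequent A.Obj (Option ↥pᶜ) ↥qᶜ}
      {h₁ : Ψ₁ = cutLeft p q Z Φ} {h₂ : Ψ₂ = cutRight p q Z Φ}
      {I : Type} [Finite I] {X : I → Form A.Obj}
      {hZ₁ : Ψ₁ (.inr none) = outForm (.inr none : p ⊕ Option q) X} (k : I)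
      {Θ₁ : Sequent A.Obj p (Option q)} {hΘ₁ : Θ₁ = repl Ψ₁ (.inr none) (X k)}
      {hZ₂ : Ψ₂ (.inl none) = inForm (.inl none : Option ↥pᶜ ⊕ ↥qᶜ) X}
      {Θ₂ : I → Sequent A.Obj (Option ↥pᶜ) ↥qᶜ} {hΘ₂ : ∀ i, Θ₂ i = repl Ψ₂ (.inl none) (X i)}
      {k₁ : Θ₁ = cutLeft p q (X k) Φ} {k₂ : Θ₂ k = cutRight p q (X k) Φ}
      (f : Deriv A Θ₁) (g : ∀ i, Deriv A (Θ₂ i)) :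
      Conv (.cut p q Z h₁ h₂ (.out (.inr none) X hZ₁ k hΘ₁ f) (.inp (.inl none) X hZ₂ hΘ₂ g))
        (.cut p q (X k) k₁ k₂ f (g k))
  -- a tupling on the cut channel meets a projection on the cut channel
  | tuple_proj {C D : Type} {Φ : Sequent A.Obj C D} {p : Set C} {q : Set D} {Z : Form A.Obj}
      {Ψ₁ : Sequent A.Obj p (Option q)} {Ψ₂ : Sequent A.Obj (Option ↥pᶜ) ↥qᶜ}
      {h₁ : Ψ₁ = cutLeft p q Z Φ} {h₂ : Ψ₂ = cutRight p q Z Φ}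
      {I : Type} [Finite I] {X : I → Form A.Obj}
      {hZ₁ : Ψ₁ (.inr none) = inForm (.inr none : p ⊕ Option q) X}
      {Θ₁ : I → Sequent A.Obj p (Option q)} {hΘ₁ : ∀ i, Θ₁ i = repl Ψ₁ (.inr none) (X i)}
      {hZ₂ : Ψ₂ (.inl none) = outForm (.inl none : Option ↥pᶜ ⊕ ↥qᶜ) X} (k : I)
      {Θ₂ : Sequent A.Obj (Option ↥pᶜ) ↥qᶜ} {hΘ₂ : Θ₂ = repl Ψ₂ (.inl none) (X k)}
      {k₁ : Θ₁ k = cutLeft p q (X k) Φ} {k₂ : Θ₂ = cutRight p q (X k) Φ}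
      (f : ∀ i, Deriv A (Θ₁ i)) (g : Deriv A Θ₂) :
      Conv (.cut p q Z h₁ h₂ (.inp (.inr none) X hZ₁ hΘ₁ f) (.out (.inl none) X hZ₂ k hΘ₂ g))
        (.cut p q (X k) k₁ k₂ (f k) g)
  -- permuting conversions: (co)tuple with (co)tuple; the index sets may be empty
  | inp_inp {C D : Type} {Φ : Sequent A.Obj C D} {α β : C ⊕ D} (hne : α ≠ β)
      {I J : Type} [Finite I] [Finite J] {X : I → Form A.Obj} {Y : J → Form A.Obj}
      {hα : Φ α = inForm α X} {hβ : Φ β = inForm β Y}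
      {Φα : I → Sequent A.Obj C D} {Φβ : J → Sequent A.Obj C D}
      {Φαβ : I → J → Sequent A.Obj C D}
      {hα' : ∀ j, Φβ j α = inForm α X} {hβ' : ∀ i, Φα i β = inForm β Y}
      {hΦα : ∀ i, Φα i = repl Φ α (X i)} {hΦβ : ∀ j, Φβ j = repl Φ β (Y j)}
      {hΦαβ : ∀ i j, Φαβ i j = repl (Φα i) β (Y j)}
      {hΦβα : ∀ i j, Φαβ i j = repl (Φβ j) α (X i)}
      (f : ∀ i j, Deriv A (Φαβ i j)) :
      Conv (.inp α X hα hΦα fun i => .inp β Y (hβ' i) (hΦαβ i) fun j => f i j)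
        (.inp β Y hβ hΦβ fun j => .inp α X (hα' j) (fun i => hΦβα i j) fun i => f i j)
  -- permuting conversions: (co)tuple with injection or projection; `I` may be empty
  | inp_out {C D : Type} {Φ : Sequent A.Obj C D} {α β : C ⊕ D} (hne : α ≠ β)
      {I J : Type} [Finite I] [Finite J] {X : I → Form A.Obj} {Y : J → Form A.Obj}
      {hα : Φ α = inForm α X} {hβ : Φ β = outForm β Y} (k : J)
      {Φα : I → Sequent A.Obj C D} {Φβ : Sequent A.Obj C D} {Φαβ : I → Sequent A.Obj C D}
      {hα' : Φβ α = inForm α X} {hβ' : ∀ i, Φα i β = outForm β Y}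
      {hΦα : ∀ i, Φα i = repl Φ α (X i)} {hΦβ : Φβ = repl Φ β (Y k)}
      {hΦαβ : ∀ i, Φαβ i = repl (Φα i) β (Y k)}
      {hΦβα : ∀ i, Φαβ i = repl Φβ α (X i)}
      (f : ∀ i, Deriv A (Φαβ i)) :
      Conv (.inp α X hα hΦα fun i => .out β Y (hβ' i) k (hΦαβ i) (f i))
        (.out β Y hβ k hΦβ (.inp α X hα' hΦβα f))
  -- permuting conversions: injection or projection with injection or projection
  | out_out {C D : Type} {Φ : Sequent A.Obj C D} {α β : C ⊕ D} (hne : α ≠ β)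
      {I J : Type} [Finite I] [Finite J] {X : I → Form A.Obj} {Y : J → Form A.Obj}
      {hα : Φ α = outForm α X} {hβ : Φ β = outForm β Y} (i : I) (j : J)
      {Φα Φβ Φαβ : Sequent A.Obj C D}
      {hα' : Φβ α = outForm α X} {hβ' : Φα β = outForm β Y}
      {hΦα : Φα = repl Φ α (X i)} {hΦβ : Φβ = repl Φ β (Y j)}
      {hΦαβ : Φαβ = repl Φα β (Y j)} {hΦβα : Φαβ = repl Φβ α (X i)}
      (f : Deriv A Φαβ) :
      Conv (.out α X hα i hΦα (.out β Y hβ' j hΦαβ f))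
        (.out β Y hβ j hΦβ (.out α X hα' i hΦβα f))

/-! ### The poly-hom-sets of `ΣΠ_A` and the inclusion of `A` -/

/-- The poly-hom-set `Hom(Γ ; Δ)` of `ΣΠ_A`: derivations of `Γ ⊢ Δ` modulo `∼`. -/
def Hom (A : Polycategory.{u, v}) {C D : Type} (Φ : Sequent A.Obj C D) : Type (max 1 u v) :=
  Quot (Conv (A := A) (Φ := Φ))

/-- The inclusion `A → ΣΠ_A` on objects. -/
def inclObj (A : Polycategory.{u, v}) (x : A.Obj) : Form A.Obj := .atom x

/-- The inclusion `A → ΣΠ_A` on polymorphisms. -/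
def inclHom (A : Polycategory.{u, v}) {C D : Type} [Finite C] [Finite D] {a : C → A.Obj}
    {b : D → A.Obj} (f : A.Hom a b) :
    Hom A (Sum.elim (fun c => inclObj A (a c)) (fun d => inclObj A (b d))) :=
  Quot.mk _ (.ax (fun _ => rfl) (fun _ => rfl) f)

/-- The map between poly-hom-sets given by the projection (`α` in the domain) or injection (`α` in
the codomain) of the event `k` on the channel `α`. -/
def outMap {A : Polycategory.{u, v}} {C D : Type} {Φ Ψ : Sequent A.Obj C D} (α : C ⊕ D)
    {I : Type} [Finite I] (X : I → Form A.Obj) (hα : Φ α = outForm α X) (k : I)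
    (hΨ : Ψ = repl Φ α (X k)) : Hom A Ψ → Hom A Φ :=
  Quot.map (Deriv.out α X hα k hΨ) fun _ _ h => Conv.out_congr h

/-- The output index of a sequent: pairs of a channel `chan` carrying an output formula (a product
in the domain, a sum in the codomain) and one of the indices `event` of that formula.  The index
set and the family of components are determined by the channel. -/
structure OutputIndex {O : Type u} {C D : Type} (Φ : Sequent O C D) : Type (max 1 u) where
  chan : C ⊕ D
  {I : Type}
  [fin : Finite I]
  X : I → Form O
  eq : Φ chan = outForm chan X
  event : I

/-- The sequent in which the formula on the channel of `x` is replaced by its component. -/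
noncomputable def OutputIndex.residue {Φ : Sequent O C D} (x : OutputIndex Φ) : Sequent O C D :=
  repl Φ x.chan (x.X x.event)

/-- The disjoint union of the poly-hom-sets `[Hom(Γ ; Δ)]_(α, i)` over the output index. -/
noncomputable def OneStep (A : Polycategory.{u, v}) {C D : Type} (Φ : Sequent A.Obj C D) : Type (max 1 u v) :=
  Σ x : OutputIndex Φ, Hom A x.residue

/-- The disjoint union of the poly-hom-sets `[Hom(Γ ; Δ)]_((α, i), (β, j))` over the pairs of
elements of the output index with `α ≠ β`. -/
noncomputable def TwoStep (A : Polycategory.{u, v}) {C D : Type} (Φ : Sequent A.Obj C D) : Type (max 1 u v) :=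
  Σ xy : {xy : OutputIndex Φ × OutputIndex Φ // xy.1.chan ≠ xy.2.chan},
    Hom A (repl xy.1.1.residue xy.1.2.chan (xy.1.2.X xy.1.2.event))

/-- The cotupling of the injection and projection maps into `Hom(Γ ; Δ)`. -/
noncomputable def oneStepMap (A : Polycategory.{u, v}) {C D : Type} (Φ : Sequent A.Obj C D) :
    OneStep A Φ → Hom A Φ :=
  fun t => haveI := t.1.fin; outMap t.1.chan t.1.X t.1.eq t.1.event rfl t.2

/-- On the summand of `((α, i), (β, j))`, the injection or projection of `j` on `β`, into the
summand of `(α, i)`. -/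
noncomputable def twoStepFst (A : Polycategory.{u, v}) {C D : Type} (Φ : Sequent A.Obj C D) :
    TwoStep A Φ → OneStep A Φ :=
  fun t => haveI := t.1.1.2.fin
    ⟨t.1.1.1, outMap t.1.1.2.chan t.1.1.2.X
      ((repl_of_ne t.1.2.symm _).trans t.1.1.2.eq) t.1.1.2.event rfl t.2⟩

/-- On the summand of `((α, i), (β, j))`, the injection or projection of `i` on `α`, into the
summand of `(β, j)`. -/
noncomputable def twoStepSnd (A : Polycategory.{u, v}) {C D : Type} (Φ : Sequent A.Obj C D) :
    TwoStep A Φ → OneStep A Φ :=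
  fun t => haveI := t.1.1.1.fin
    ⟨t.1.1.2, outMap t.1.1.1.chan t.1.1.1.X
      ((repl_of_ne t.1.2 _).trans t.1.1.1.eq) t.1.1.1.event (repl_comm t.1.2 _ _) t.2⟩

/-- `Hom(Γ ; Δ)` is an output poly-hom-set: every channel carries an object of `A` or an output
formula (a product in the domain, a sum in the codomain), and at least one carries an output
formula. -/
def IsOutput (A : Polycategory.{u, v}) {C D : Type} (Φ : Sequent A.Obj C D) : Prop :=
  (∀ α, (∃ x, Φ α = inclObj A x) ∨
    ∃ (I : Type) (_ : Finite I) (X : I → Form A.Obj), Φ α = outForm α X) ∧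
  ∃ (α : C ⊕ D) (I : Type) (_ : Finite I) (X : I → Form A.Obj), Φ α = outForm α X

/-- The inclusion `A → ΣΠ_A` is a semi-soft extension. -/
def IsSemiSoftExtension (A : Polycategory.{u, v}) : Prop :=
  ∀ (C D : Type) [Finite C] [Finite D] (Φ : Sequent A.Obj C D), IsOutput A Φ →
    Function.Surjective (oneStepMap A Φ)

open CategoryTheory CategoryTheory.Limits in
/-- The inclusion `A → ΣΠ_A` is a soft extension: for every output poly-hom-set the diagram
`TwoStep ⇉ OneStep → Hom` is a coequalizer diagram in the category of sets. -/
def IsSoftExtension (A : Polycategory.{u, v}) : Prop :=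
  ∀ (C D : Type) [Finite C] [Finite D] (Φ : Sequent A.Obj C D), IsOutput A Φ →
    ∃ w : TypeCat.ofHom (twoStepFst A Φ) ≫ TypeCat.ofHom (oneStepMap A Φ) =
        TypeCat.ofHom (twoStepSnd A Φ) ≫ TypeCat.ofHom (oneStepMap A Φ),
      Nonempty (IsColimit (Cofork.ofπ (TypeCat.ofHom (oneStepMap A Φ)) w))

/-- The inclusion `A → ΣΠ_A` is soft. -/
def InclusionIsSoft (A : Polycategory.{u, v}) : Prop :=
  IsSemiSoftExtension A ∧ IsSoftExtension A

end SigmaPi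

namespace SigmaPi

/-! ### Polarised channels and cut-free proofs -/

/-! The proof is by cut elimination, carried out so as to give a complete invariant of `∼`. Every
derivation `f` gets a cut-free normal form `f.nf`. Two facts carry the theorem: `f` is
`∼`-equivalent to its normal form (`conv_nf`), and `∼`-equivalent derivations have normal forms
related by the permuting conversions alone (`Conv.nf`). Hence a poly-hom-set is the set of cut-free
derivations modulo `PermEq`.

Softness is then read off from the last rule. On an output poly-hom-set a cut-free derivation can
end neither with an axiom, since some formula is compound, nor with a cotupling or tupling, since no
channel carries an input formula; so it is a projection or an injection, which gives surjectivity. A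
chain of permuting conversions between two such derivations changes the last rule only through the
exchange of two output rules on different channels, which is an identification made by the parallel
pair (`PermEq.oneStep`). The remaining steps change only the class representative of the premise. So
the kernel of the one-step map is the equivalence relation generated by the pair, and a surjection
with that kernel is the coequalizer.

The work lies in `Conv.nf`, that is, in showing that cut elimination respects the relation. The
function `Junction.cut` is biased: it consumes the left premise first, and reaches the right one
only when the left rule is an axiom or acts on the cut channel. Thus commutation with left rules and
the principal reductions hold as equations, while commutation with right rules (`cut_inp_right`,
`cut_out_right`) holds up to permuting conversions. The bias is removed by `cut_flip`: cutting in
the other order gives a `PermEq` result. Congruence in the left argument (`cut_congr_left`) then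
yields congruence in both (`cut_congr`), and the unit law on the left follows from the one on the
right.

The duality between domain and codomain is built into the syntax: each channel has a polarity, and
the four logical rules become two, an input rule and an output rule. Axioms are abstract at this
level, which is why exchanging the premises of a cut stays within the setting. -/

/-- The compound formula which is a sum or a product according to `b`. -/
def Form.node {O : Type u} (b : Bool) {I : Type} [Finite I] (X : I → Form O) : Form O :=
  bif b then .sum X else .prod X

theorem Form.node_inj {O : Type u} {b : Bool} {I J : Type} [Finite I] [Finite J]
    {X : I → Form O} {Y : J → Form O} (h : Form.node b X = Form.node b Y) : I = J ∧ X ≍ Y := by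
  cases b
  · exact Form.prod.inj h
  · exact Form.sum.inj h

theorem Form.node_ne_node_not {O : Type u} {b : Bool} {I J : Type} [Finite I] [Finite J]
    {X : I → Form O} {Y : J → Form O} : Form.node b X ≠ Form.node (!b) Y := by
  cases b <;> simp [Form.node]

theorem Form.node_ne_atom {O : Type u} {b : Bool} {I : Type} [Finite I]
    {X : I → Form O} {x : O} : Form.node b X ≠ .atom x := by
  cases b <;> simp [Form.node]

/-- The index of the first of two equal compound formulas given by an index of the second. -/
def Form.idx {O : Type u} {b : Bool} {I J : Type} [Finite I] [Finite J]
    {X : I → Form O} {Y : J → Form O} (h : Form.node b X = Form.node b Y) (k : J) : I :=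
  cast (Form.node_inj h).1.symm k

theorem Form.apply_idx {O : Type u} {b : Bool} {I J : Type} [Finite I] [Finite J]
    {X : I → Form O} {Y : J → Form O} (h : Form.node b X = Form.node b Y) (k : J) :
    X (Form.idx h k) = Y k := by
  obtain ⟨rfl, h'⟩ := Form.node_inj h
  obtain rfl := eq_of_heq h'
  rfl

open scoped Classical in
/-- Replace the value of `Φ` at `s`. -/
noncomputable def upd {O : Type u} {S : Type} (Φ : S → Form O) (s : S) (X : Form O) :
    S → Form O := fun t => if t = s then X else Φ t

section
variable {O : Type u} {S : Type} {Φ : S → Form O} {s t : S} {X Y : Form O}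

theorem upd_self : upd Φ s X s = X := by simp [upd]

theorem upd_of_ne (h : t ≠ s) : upd Φ s X t = Φ t := by simp [upd, h]

theorem upd_comm (h : s ≠ t) : upd (upd Φ s X) t Y = upd (upd Φ t Y) s X := by
  funext r
  by_cases h₁ : r = s
  · subst h₁; rw [upd_of_ne h, upd_self, upd_self]
  · by_cases h₂ : r = t
    · subst h₂; rw [upd_self, upd_of_ne h₁, upd_self]
    · rw [upd_of_ne h₂, upd_of_ne h₁, upd_of_ne h₁, upd_of_ne h₂]

end

/-- A type of channels, each of which is in the domain (`pol = true`) or in the codomain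
(`pol = false`), together with axioms on these channels. -/
structure Board (O : Type u) where
  chan : Type
  pol : chan → Bool
  Ax : (chan → Form O) → Type v
  atomic : ∀ {Φ : chan → Form O}, Ax Φ → ∀ s, ∃ x, Φ s = .atom x

variable {O : Type u}

/-- Cut-free derivations. -/
inductive CutFree (B : Board.{u, v} O) : (B.chan → Form O) → Type (max 1 u v)
  | ax {Φ : B.chan → Form O} (x : B.Ax Φ) : CutFree B Φ
  | inp {Φ : B.chan → Form O} (s : B.chan) {I : Type} [Finite I] (X : I → Form O)
      (hs : Φ s = .node (B.pol s) X) {Ψ : I → B.chan → Form O}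
      (hΨ : ∀ i, Ψ i = upd Φ s (X i)) (f : ∀ i, CutFree B (Ψ i)) : CutFree B Φ
  | out {Φ : B.chan → Form O} (s : B.chan) {I : Type} [Finite I] (X : I → Form O)
      (hs : Φ s = .node (!B.pol s) X) (k : I) {Ψ : B.chan → Form O}
      (hΨ : Ψ = upd Φ s (X k)) (f : CutFree B Ψ) : CutFree B Φ

/-- The congruence on cut-free derivations generated by the permuting conversions. -/
inductive PermEq {B : Board.{u, v} O} :
    {Φ : B.chan → Form O} → CutFree B Φ → CutFree B Φ → Prop
  | refl {Φ : B.chan → Form O} (f : CutFree B Φ) : PermEq f f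
  | symm {Φ : B.chan → Form O} {f g : CutFree B Φ} : PermEq f g → PermEq g f
  | trans {Φ : B.chan → Form O} {f g h : CutFree B Φ} : PermEq f g → PermEq g h → PermEq f h
  | inp_congr {Φ : B.chan → Form O} {s : B.chan} {I : Type} [Finite I] {X : I → Form O}
      {hs : Φ s = .node (B.pol s) X} {Ψ : I → B.chan → Form O}
      {hΨ : ∀ i, Ψ i = upd Φ s (X i)} {f g : ∀ i, CutFree B (Ψ i)} :
      (∀ i, PermEq (f i) (g i)) → PermEq (.inp s X hs hΨ f) (.inp s X hs hΨ g)
  | out_congr {Φ : B.chan → Form O} {s : B.chan} {I : Type} [Finite I] {X : I → Form O}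
      {hs : Φ s = .node (!B.pol s) X} {k : I} {Ψ : B.chan → Form O}
      {hΨ : Ψ = upd Φ s (X k)} {f g : CutFree B Ψ} :
      PermEq f g → PermEq (.out s X hs k hΨ f) (.out s X hs k hΨ g)
  | inp_inp {Φ : B.chan → Form O} {s t : B.chan} (hne : s ≠ t) {I J : Type} [Finite I] [Finite J]
      {X : I → Form O} {Y : J → Form O}
      {hs : Φ s = .node (B.pol s) X} {ht : Φ t = .node (B.pol t) Y}
      {Φs : I → B.chan → Form O} {Φt : J → B.chan → Form O} {Φst : I → J → B.chan → Form O}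
      {hs' : ∀ j, Φt j s = .node (B.pol s) X} {ht' : ∀ i, Φs i t = .node (B.pol t) Y}
      {hΦs : ∀ i, Φs i = upd Φ s (X i)} {hΦt : ∀ j, Φt j = upd Φ t (Y j)}
      {hΦst : ∀ i j, Φst i j = upd (Φs i) t (Y j)} {hΦts : ∀ i j, Φst i j = upd (Φt j) s (X i)}
      (f : ∀ i j, CutFree B (Φst i j)) :
      PermEq (.inp s X hs hΦs fun i => .inp t Y (ht' i) (hΦst i) fun j => f i j)
        (.inp t Y ht hΦt fun j => .inp s X (hs' j) (fun i => hΦts i j) fun i => f i j)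
  | inp_out {Φ : B.chan → Form O} {s t : B.chan} (hne : s ≠ t) {I J : Type} [Finite I] [Finite J]
      {X : I → Form O} {Y : J → Form O}
      {hs : Φ s = .node (B.pol s) X} {ht : Φ t = .node (!B.pol t) Y} (k : J)
      {Φs : I → B.chan → Form O} {Φt : B.chan → Form O} {Φst : I → B.chan → Form O}
      {hs' : Φt s = .node (B.pol s) X} {ht' : ∀ i, Φs i t = .node (!B.pol t) Y}
      {hΦs : ∀ i, Φs i = upd Φ s (X i)} {hΦt : Φt = upd Φ t (Y k)}
      {hΦst : ∀ i, Φst i = upd (Φs i) t (Y k)} {hΦts : ∀ i, Φst i = upd Φt s (X i)}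
      (f : ∀ i, CutFree B (Φst i)) :
      PermEq (.inp s X hs hΦs fun i => .out t Y (ht' i) k (hΦst i) (f i))
        (.out t Y ht k hΦt (.inp s X hs' hΦts f))
  | out_out {Φ : B.chan → Form O} {s t : B.chan} (hne : s ≠ t) {I J : Type} [Finite I] [Finite J]
      {X : I → Form O} {Y : J → Form O}
      {hs : Φ s = .node (!B.pol s) X} {ht : Φ t = .node (!B.pol t) Y} (i : I) (j : J)
      {Φs Φt Φst : B.chan → Form O}
      {hs' : Φt s = .node (!B.pol s) X} {ht' : Φs t = .node (!B.pol t) Y}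
      {hΦs : Φs = upd Φ s (X i)} {hΦt : Φt = upd Φ t (Y j)}
      {hΦst : Φst = upd Φs t (Y j)} {hΦts : Φst = upd Φt s (X i)}
      (f : CutFree B Φst) :
      PermEq (.out s X hs i hΦs (.out t Y ht' j hΦst f))
        (.out t Y ht j hΦt (.out s X hs' i hΦts f))

/-! ### Wirings of cuts -/

/-- The channels of the premises of a cut are those of its conclusion, except for the cut
channels `c₁` and `c₂`, which have opposite polarities. -/
structure Wiring (B₁ B₂ B : Board.{u, v} O) where
  c₁ : B₁.chan
  c₂ : B₂.chan
  pol_cut : B₂.pol c₂ = !B₁.pol c₁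
  j₁ : B₁.chan → Option B.chan
  j₂ : B₂.chan → Option B.chan
  j₁_cut : j₁ c₁ = none
  j₂_cut : j₂ c₂ = none
  inj₁ : Function.Injective j₁
  inj₂ : Function.Injective j₂
  disj : ∀ {s t r}, j₁ s = some r → j₂ t ≠ some r
  pol₁ : ∀ {s r}, j₁ s = some r → B.pol r = B₁.pol s
  pol₂ : ∀ {s r}, j₂ s = some r → B.pol r = B₂.pol s

variable {B₁ B₂ B : Board.{u, v} O}

/-- `Φ` is the conclusion of a cut with premises `Φ₁` and `Φ₂`. -/
structure Wiring.IsCut (W : Wiring B₁ B₂ B) (Φ₁ : B₁.chan → Form O) (Φ₂ : B₂.chan → Form O)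
    (Φ : B.chan → Form O) : Prop where
  mid : Φ₁ W.c₁ = Φ₂ W.c₂
  left : ∀ {s r}, W.j₁ s = some r → Φ r = Φ₁ s
  right : ∀ {s r}, W.j₂ s = some r → Φ r = Φ₂ s

/-- The wiring with the premises exchanged. -/
def Wiring.flip (W : Wiring B₁ B₂ B) : Wiring B₂ B₁ B where
  c₁ := W.c₂
  c₂ := W.c₁
  pol_cut := by rw [W.pol_cut, Bool.not_not]
  j₁ := W.j₂
  j₂ := W.j₁
  j₁_cut := W.j₂_cut
  j₂_cut := W.j₁_cut
  inj₁ := W.inj₂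
  inj₂ := W.inj₁
  disj h h' := W.disj h' h
  pol₁ := W.pol₂
  pol₂ := W.pol₁

namespace Wiring
variable {W : Wiring B₁ B₂ B} {Φ₁ Ψ₁ : B₁.chan → Form O} {Φ₂ Ψ₂ : B₂.chan → Form O}
  {Φ Ψ : B.chan → Form O} {s : B₁.chan} {t : B₂.chan} {r r' : B.chan} {X : Form O}

theorem IsCut.flip (h : W.IsCut Φ₁ Φ₂ Φ) : W.flip.IsCut Φ₂ Φ₁ Φ := ⟨h.mid.symm, h.right, h.left⟩

theorem eq_cut₁ (h : W.j₁ s = none) : s = W.c₁ := W.inj₁ (h.trans W.j₁_cut.symm)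

theorem eq_cut₂ (h : W.j₂ t = none) : t = W.c₂ := W.inj₂ (h.trans W.j₂_cut.symm)

/-- A rule on a side channel can be undone in the premise and in the conclusion at once: `s` is not
the cut channel because `j₁ s` is defined, and disjointness protects the other premise. Every
commutation of a cut with a rule rests on this. -/
theorem IsCut.upd_left (h : W.IsCut Φ₁ Φ₂ Φ) (hj : W.j₁ s = some r) (h₁ : Ψ₁ = upd Φ₁ s X)
    (hΨ : Ψ = upd Φ r X) : W.IsCut Ψ₁ Φ₂ Ψ := by
  subst h₁ hΨ
  refine ⟨?_, fun {s' r'} h' => ?_, fun {s' r'} h' => ?_⟩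
  · rw [upd_of_ne, h.mid]
    rintro rfl
    simp [W.j₁_cut] at hj
  · by_cases hs : s' = s
    · subst hs
      obtain rfl : r = r' := Option.some.inj (hj.symm.trans h')
      rw [upd_self, upd_self]
    · rw [upd_of_ne hs, upd_of_ne, h.left h']
      rintro rfl
      exact hs (W.inj₁ (h'.trans hj.symm))
  · rw [upd_of_ne, h.right h']
    rintro rfl
    exact W.disj hj h'

theorem IsCut.upd_right (h : W.IsCut Φ₁ Φ₂ Φ) (hj : W.j₂ t = some r) (h₂ : Ψ₂ = upd Φ₂ t X)
    (hΨ : Ψ = upd Φ r X) : W.IsCut Φ₁ Ψ₂ Ψ :=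
  (h.flip.upd_left (W := W.flip) hj h₂ hΨ).flip

/-- The conclusion does not see the cut channels, so it is unchanged when the cut formula is
replaced by the same component on both sides. This is the sequent-level content of a principal
reduction. -/
theorem IsCut.upd_mid (h : W.IsCut Φ₁ Φ₂ Φ) (h₁ : Ψ₁ = upd Φ₁ W.c₁ X)
    (h₂ : Ψ₂ = upd Φ₂ W.c₂ X) : W.IsCut Ψ₁ Ψ₂ Φ := by
  subst h₁ h₂
  refine ⟨by rw [upd_self, upd_self], fun {s' r'} h' => ?_, fun {s' r'} h' => ?_⟩
  · rw [upd_of_ne, h.left h']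
    rintro rfl
    simp [W.j₁_cut] at h'
  · rw [upd_of_ne, h.right h']
    rintro rfl
    simp [W.j₂_cut] at h'

end Wiring

/-- A wiring of cuts, with a composition of axioms. -/
structure Junction (B₁ B₂ B : Board.{u, v} O) extends Wiring B₁ B₂ B where
  axCut : ∀ {Φ₁ Φ₂ Φ}, toWiring.IsCut Φ₁ Φ₂ Φ → B₁.Ax Φ₁ → B₂.Ax Φ₂ → B.Ax Φ

/-- The junction with the premises exchanged. -/
def Junction.flip (W : Junction B₁ B₂ B) : Junction B₂ B₁ B where
  toWiring := W.toWiring.flip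
  axCut h x y := W.axCut h.flip y x

theorem Wiring.IsCut.swap {W : Junction B₁ B₂ B} {Φ₁ : B₁.chan → Form O} {Φ₂ : B₂.chan → Form O}
    {Φ : B.chan → Form O} (h : W.IsCut Φ₁ Φ₂ Φ) : W.flip.IsCut Φ₂ Φ₁ Φ := Wiring.IsCut.flip h

/-! ### Cut elimination -/

/-- The last rule of `f` is an axiom or acts on the channel `c`. -/
def CutFree.Principal {B : Board.{u, v} O} (c : B.chan) {Φ : B.chan → Form O} :
    CutFree B Φ → Prop
  | .ax _ => True
  | @CutFree.inp _ _ _ s _ _ _ _ _ _ _ => s = c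
  | @CutFree.out _ _ _ s _ _ _ _ _ _ _ _ => s = c

theorem CutFree.principal_ax {B : Board.{u, v} O} {c : B.chan} {Φ : B.chan → Form O}
    (x : B.Ax Φ) : (CutFree.ax x).Principal c := trivial

theorem CutFree.principal_inp {B : Board.{u, v} O} {c s : B.chan} {Φ : B.chan → Form O}
    (h : s = c) {I : Type} [Finite I] {X : I → Form O} {hs : Φ s = .node (B.pol s) X}
    {Ψ : I → B.chan → Form O} {hΨ : ∀ i, Ψ i = upd Φ s (X i)} {f : ∀ i, CutFree B (Ψ i)} :
    (CutFree.inp s X hs hΨ f).Principal c := h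

theorem CutFree.principal_out {B : Board.{u, v} O} {c s : B.chan} {Φ : B.chan → Form O}
    (h : s = c) {I : Type} [Finite I] {X : I → Form O} {hs : Φ s = .node (!B.pol s) X} {k : I}
    {Ψ : B.chan → Form O} {hΨ : Ψ = upd Φ s (X k)} {f : CutFree B Ψ} :
    (CutFree.out s X hs k hΨ f).Principal c := h

namespace Junction
variable (W : Junction B₁ B₂ B)

/-- Move a cut above the rules of the right premise that do not act on the cut channel. -/
noncomputable def push {Φ₁ : B₁.chan → Form O}
    (H : ∀ {Φ₂ Φ} (g : CutFree B₂ Φ₂), g.Principal W.c₂ → W.IsCut Φ₁ Φ₂ Φ → CutFree B Φ) :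
    ∀ {Φ₂ Φ}, CutFree B₂ Φ₂ → W.IsCut Φ₁ Φ₂ Φ → CutFree B Φ
  | _, _, .ax y, hc => H (.ax y) (CutFree.principal_ax y) hc
  -- `none` says that the rule acts on the cut channel, so that `H` takes over; otherwise the rule
  -- survives on the channel `r` of the conclusion.
  | _, _, @CutFree.inp _ _ _ t _ _ Y ht _ hΨ g, hc =>
    match hj : W.j₂ t with
    | none => H (.inp t Y ht hΨ g) (CutFree.principal_inp (Wiring.eq_cut₂ hj)) hc
    | some r => .inp r Y (by rw [hc.right hj, W.pol₂ hj, ht]) (fun _ => rfl)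
        fun j => push H (g j) (hc.upd_right hj (hΨ j) rfl)
  | _, _, @CutFree.out _ _ _ t _ _ Y ht k _ hΨ g, hc =>
    match hj : W.j₂ t with
    | none => H (.out t Y ht k hΨ g) (CutFree.principal_out (Wiring.eq_cut₂ hj)) hc
    | some r => .out r Y (by rw [hc.right hj, W.pol₂ hj, ht]) k rfl
        (push H g (hc.upd_right hj hΨ rfl))

/-- Cut an axiom with a derivation whose last rule is principal. -/
noncomputable def axHead {Φ₁ : B₁.chan → Form O} (x : B₁.Ax Φ₁) {Φ₂ Φ} :
    (g : CutFree B₂ Φ₂) → g.Principal W.c₂ → W.IsCut Φ₁ Φ₂ Φ → CutFree B Φ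
  | .ax y, _, hc => .ax (W.axCut hc x y)
  -- The cut formula is an atom, because the left premise is an axiom, so no rule can act on it.
  | @CutFree.inp _ _ _ t _ _ Y ht _ _ _, hp, hc => False.elim (by
      obtain ⟨x, hx⟩ := B₁.atomic x W.c₁
      obtain rfl : t = W.c₂ := hp
      exact Form.node_ne_atom (ht.symm.trans (hc.mid.symm.trans hx)))
  | @CutFree.out _ _ _ t _ _ Y ht _ _ _ _, hp, hc => False.elim (by
      obtain ⟨x, hx⟩ := B₁.atomic x W.c₁
      obtain rfl : t = W.c₂ := hp
      exact Form.node_ne_atom (ht.symm.trans (hc.mid.symm.trans hx)))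

/-- Cut an input rule on the cut channel with a derivation whose last rule is principal. -/
noncomputable def inpHead {Φ₁ : B₁.chan → Form O} {I : Type} [Finite I] (X : I → Form O)
    (hX : Φ₁ W.c₁ = .node (B₁.pol W.c₁) X) {Ψ : I → B₁.chan → Form O}
    (hΨ : ∀ i, Ψ i = upd Φ₁ W.c₁ (X i))
    (F : ∀ i {Φ₂ Φ}, CutFree B₂ Φ₂ → W.IsCut (Ψ i) Φ₂ Φ → CutFree B Φ) {Φ₂ Φ} :
    (g : CutFree B₂ Φ₂) → g.Principal W.c₂ → W.IsCut Φ₁ Φ₂ Φ → CutFree B Φ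
  | .ax y, _, hc => False.elim (by
      obtain ⟨x, hx⟩ := B₂.atomic y W.c₂
      exact Form.node_ne_atom (hX.symm.trans (hc.mid.trans hx)))
  -- Input rules on both cut channels would make the cut formula a sum and a product at once, since
  -- the polarities are opposite.
  | @CutFree.inp _ _ _ t _ _ Y ht _ _ _, hp, hc => False.elim (by
      obtain rfl : t = W.c₂ := hp
      rw [W.pol_cut] at ht
      exact Form.node_ne_node_not (hX.symm.trans (hc.mid.trans ht)))
  -- The two families of components agree only propositionally, so the index `k` chosen by the
  -- output rule is transported to `I`.
  | @CutFree.out _ _ _ t _ _ Y ht k _ hΘ g, hp, hc =>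
    have h : Form.node (B₁.pol W.c₁) X = .node (B₁.pol W.c₁) Y := by
      obtain rfl : t = W.c₂ := hp
      rw [← hX, hc.mid, ht, W.pol_cut, Bool.not_not]
    F (Form.idx h k) g (hc.upd_mid (hΨ _) (by
      obtain rfl : t = W.c₂ := hp
      rw [Form.apply_idx h, hΘ]))

/-- Cut an output rule on the cut channel with a derivation whose last rule is principal. -/
noncomputable def outHead {Φ₁ : B₁.chan → Form O} {I : Type} [Finite I] (X : I → Form O)
    (hX : Φ₁ W.c₁ = .node (!B₁.pol W.c₁) X) (k : I) {Ψ : B₁.chan → Form O}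
    (hΨ : Ψ = upd Φ₁ W.c₁ (X k))
    (F : ∀ {Φ₂ Φ}, CutFree B₂ Φ₂ → W.IsCut Ψ Φ₂ Φ → CutFree B Φ) {Φ₂ Φ} :
    (g : CutFree B₂ Φ₂) → g.Principal W.c₂ → W.IsCut Φ₁ Φ₂ Φ → CutFree B Φ
  | .ax y, _, hc => False.elim (by
      obtain ⟨x, hx⟩ := B₂.atomic y W.c₂
      exact Form.node_ne_atom (hX.symm.trans (hc.mid.trans hx)))
  | @CutFree.out _ _ _ t _ _ Y ht _ _ _ _, hp, hc => False.elim (by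
      obtain rfl : t = W.c₂ := hp
      rw [W.pol_cut] at ht
      exact Form.node_ne_node_not (hX.symm.trans (hc.mid.trans ht)))
  | @CutFree.inp _ _ _ t _ _ Y ht _ hΘ g, hp, hc =>
    have h : Form.node (!B₁.pol W.c₁) Y = .node (!B₁.pol W.c₁) X := by
      obtain rfl : t = W.c₂ := hp
      rw [← hX, hc.mid, ht, W.pol_cut]
    F (g (Form.idx h k)) (hc.upd_mid hΨ (by
      obtain rfl : t = W.c₂ := hp
      rw [hΘ, Form.apply_idx h]))

/-- Cut elimination. -/
noncomputable def cut : ∀ {Φ₁ : B₁.chan → Form O}, CutFree B₁ Φ₁ →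
    ∀ {Φ₂ Φ}, CutFree B₂ Φ₂ → W.IsCut Φ₁ Φ₂ Φ → CutFree B Φ
  | _, .ax x => W.push (W.axHead x)
  | _, @CutFree.inp _ _ _ s _ _ X hs _ hΨ f => fun g hc =>
    match hj : W.j₁ s with
    -- Both here and on side channels the recursive calls go to immediate subderivations of the left
    -- premise. The recursion is therefore structural on it, with no measure on the cut formula.
    | none => W.push (W.inpHead X (Wiring.eq_cut₁ hj ▸ hs) (Wiring.eq_cut₁ hj ▸ hΨ)
        fun i {_ _} g hc => cut (f i) g hc) g hc
    | some r => .inp r X (by rw [hc.left hj, W.pol₁ hj, hs]) (fun _ => rfl)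
        fun i => cut (f i) g (hc.upd_left hj (hΨ i) rfl)
  | _, @CutFree.out _ _ _ s _ _ X hs k _ hΨ f => fun g hc =>
    match hj : W.j₁ s with
    | none => W.push (W.outHead X (Wiring.eq_cut₁ hj ▸ hs) k (Wiring.eq_cut₁ hj ▸ hΨ)
        fun {_ _} g hc => cut f g hc) g hc
    | some r => .out r X (by rw [hc.left hj, W.pol₁ hj, hs]) k rfl
        (cut f g (hc.upd_left hj hΨ rfl))

end Junction

end SigmaPi

/-! ### Equations for cut elimination and its commutation with rules of the right premise -/

namespace SigmaPi
variable {O : Type u} {B₁ B₂ B : Board.{u, v} O}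

namespace Junction
variable {W : Junction B₁ B₂ B}

section
variable {Φ₁ : B₁.chan → Form O} {Φ₂ : B₂.chan → Form O} {Φ : B.chan → Form O}
  (hc : W.IsCut Φ₁ Φ₂ Φ)

theorem cut_ax_ax (x : B₁.Ax Φ₁) (y : B₂.Ax Φ₂) :
    W.cut (.ax x) (.ax y) hc = .ax (W.axCut hc x y) := rfl

/-- Left rules come out by definition. The new premises `Θ` are given up to propositional equality,
so that the result of replacing two formulas can be presented in either order. -/
theorem cut_inp_left {s : B₁.chan} {I : Type} [Finite I] {X : I → Form O}
    {hs : Φ₁ s = .node (B₁.pol s) X} {Ψ : I → B₁.chan → Form O}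
    {hΨ : ∀ i, Ψ i = upd Φ₁ s (X i)} (f : ∀ i, CutFree B₁ (Ψ i)) (g : CutFree B₂ Φ₂) {r : B.chan}
    (hj : W.j₁ s = some r) {Θ : I → B.chan → Form O} (hΘ : ∀ i, Θ i = upd Φ r (X i)) :
    W.cut (.inp s X hs hΨ f) g hc =
      .inp r X (by rw [hc.left hj, W.pol₁ hj, hs]) hΘ
        fun i => W.cut (f i) g (hc.upd_left hj (hΨ i) (hΘ i)) := by
  obtain rfl : Θ = fun i => upd Φ r (X i) := funext hΘ
  rw [cut]
  split
  · next h => exact absurd (hj.symm.trans h) (by simp)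
  · next r' hj' =>
    obtain rfl : r = r' := Option.some.inj (hj.symm.trans hj')
    rfl

theorem cut_out_left {s : B₁.chan} {I : Type} [Finite I] {X : I → Form O}
    {hs : Φ₁ s = .node (!B₁.pol s) X} {k : I} {Ψ : B₁.chan → Form O}
    {hΨ : Ψ = upd Φ₁ s (X k)} (f : CutFree B₁ Ψ) (g : CutFree B₂ Φ₂) {r : B.chan}
    (hj : W.j₁ s = some r) {Θ : B.chan → Form O} (hΘ : Θ = upd Φ r (X k)) :
    W.cut (.out s X hs k hΨ f) g hc =
      .out r X (by rw [hc.left hj, W.pol₁ hj, hs]) k hΘ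
        (W.cut f g (hc.upd_left hj hΨ hΘ)) := by
  subst hΘ
  rw [cut]
  split
  · next h => exact absurd (hj.symm.trans h) (by simp)
  · next r' hj' =>
    obtain rfl : r = r' := Option.some.inj (hj.symm.trans hj')
    rfl

variable (H : ∀ {Φ₂ Φ} (g : CutFree B₂ Φ₂), g.Principal W.c₂ → W.IsCut Φ₁ Φ₂ Φ → CutFree B Φ)

theorem push_inp {t : B₂.chan} {I : Type} [Finite I] {X : I → Form O}
    {ht : Φ₂ t = .node (B₂.pol t) X} {Ψ : I → B₂.chan → Form O}
    {hΨ : ∀ i, Ψ i = upd Φ₂ t (X i)} (g : ∀ i, CutFree B₂ (Ψ i)) {r : B.chan}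
    (hj : W.j₂ t = some r) {Θ : I → B.chan → Form O} (hΘ : ∀ i, Θ i = upd Φ r (X i)) :
    W.push H (.inp t X ht hΨ g) hc =
      .inp r X (by rw [hc.right hj, W.pol₂ hj, ht]) hΘ
        fun i => W.push H (g i) (hc.upd_right hj (hΨ i) (hΘ i)) := by
  obtain rfl : Θ = fun i => upd Φ r (X i) := funext hΘ
  rw [push]
  split
  · next h => exact absurd (hj.symm.trans h) (by simp)
  · next r' hj' =>
    obtain rfl : r = r' := Option.some.inj (hj.symm.trans hj')
    rfl

theorem push_out {t : B₂.chan} {I : Type} [Finite I] {X : I → Form O}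
    {ht : Φ₂ t = .node (!B₂.pol t) X} {k : I} {Ψ : B₂.chan → Form O}
    {hΨ : Ψ = upd Φ₂ t (X k)} (g : CutFree B₂ Ψ) {r : B.chan}
    (hj : W.j₂ t = some r) {Θ : B.chan → Form O} (hΘ : Θ = upd Φ r (X k)) :
    W.push H (.out t X ht k hΨ g) hc =
      .out r X (by rw [hc.right hj, W.pol₂ hj, ht]) k hΘ
        (W.push H g (hc.upd_right hj hΨ hΘ)) := by
  subst hΘ
  rw [push]
  split
  · next h => exact absurd (hj.symm.trans h) (by simp)
  · next r' hj' =>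
    obtain rfl : r = r' := Option.some.inj (hj.symm.trans hj')
    rfl

theorem push_principal (g : CutFree B₂ Φ₂) (hg : g.Principal W.c₂) :
    W.push H g hc = H g hg hc := by
  cases g with
  | ax y => rfl
  | inp t X ht hΨ g =>
    obtain rfl : t = W.c₂ := hg
    rw [push]
    split
    · rfl
    · next hj => simp [W.j₂_cut] at hj
  | out t X ht k hΨ g =>
    obtain rfl : t = W.c₂ := hg
    rw [push]
    split
    · rfl
    · next hj => simp [W.j₂_cut] at hj

/-- A cut with principal left premise is pushed above the right premise. -/
theorem exists_cut_eq_push (f : CutFree B₁ Φ₁) (hf : f.Principal W.c₁) :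
    ∃ H : ∀ {Φ₂ Φ} (g : CutFree B₂ Φ₂), g.Principal W.c₂ → W.IsCut Φ₁ Φ₂ Φ → CutFree B Φ,
      ∀ {Φ₂ Φ} (g : CutFree B₂ Φ₂) (hc : W.IsCut Φ₁ Φ₂ Φ), W.cut f g hc = W.push H g hc := by
  cases f with
  | ax x => exact ⟨W.axHead x, fun g hc => rfl⟩
  | inp s X hs hΨ f =>
    obtain rfl : s = W.c₁ := hf
    refine ⟨W.inpHead X hs hΨ fun i {_ _} g hc => W.cut (f i) g hc, fun g hc => ?_⟩
    rw [cut]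
    split
    · rfl
    · next hj => simp [W.j₁_cut] at hj
  | out s X hs k hΨ f =>
    obtain rfl : s = W.c₁ := hf
    refine ⟨W.outHead X hs k hΨ fun {_ _} g hc => W.cut f g hc, fun g hc => ?_⟩
    rw [cut]
    split
    · rfl
    · next hj => simp [W.j₁_cut] at hj

/-- When the left premise is principal, `cut` is `push`; the right rule then comes out as an
equation and not merely up to `PermEq`. -/
theorem cut_principal_inp {f : CutFree B₁ Φ₁} (hf : f.Principal W.c₁)
    {t : B₂.chan} {I : Type} [Finite I] {X : I → Form O}
    {ht : Φ₂ t = .node (B₂.pol t) X} {Ψ : I → B₂.chan → Form O}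
    {hΨ : ∀ i, Ψ i = upd Φ₂ t (X i)} (g : ∀ i, CutFree B₂ (Ψ i)) {r : B.chan}
    (hj : W.j₂ t = some r) {Θ : I → B.chan → Form O} (hΘ : ∀ i, Θ i = upd Φ r (X i)) :
    W.cut f (.inp t X ht hΨ g) hc =
      .inp r X (by rw [hc.right hj, W.pol₂ hj, ht]) hΘ
        fun i => W.cut f (g i) (hc.upd_right hj (hΨ i) (hΘ i)) := by
  obtain ⟨H, hH⟩ := exists_cut_eq_push f hf
  simp only [hH]
  exact push_inp hc H g hj hΘ

theorem cut_principal_out {f : CutFree B₁ Φ₁} (hf : f.Principal W.c₁)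
    {t : B₂.chan} {I : Type} [Finite I] {X : I → Form O}
    {ht : Φ₂ t = .node (!B₂.pol t) X} {k : I} {Ψ : B₂.chan → Form O}
    {hΨ : Ψ = upd Φ₂ t (X k)} (g : CutFree B₂ Ψ) {r : B.chan}
    (hj : W.j₂ t = some r) {Θ : B.chan → Form O} (hΘ : Θ = upd Φ r (X k)) :
    W.cut f (.out t X ht k hΨ g) hc =
      .out r X (by rw [hc.right hj, W.pol₂ hj, ht]) k hΘ
        (W.cut f g (hc.upd_right hj hΨ hΘ)) := by
  obtain ⟨H, hH⟩ := exists_cut_eq_push f hf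
  simp only [hH]
  exact push_out hc H g hj hΘ

/-- Both premises are principal, so `push` stops at once and `inpHead` selects the component; as the
families coincide, the transport of the index is trivial. -/
theorem cut_inp_out {s : B₁.chan} {t : B₂.chan} (hs : s = W.c₁) (ht : t = W.c₂)
    {I : Type} [Finite I] {X : I → Form O}
    {hX : Φ₁ s = .node (B₁.pol s) X} {Ψ : I → B₁.chan → Form O}
    {hΨ : ∀ i, Ψ i = upd Φ₁ s (X i)} (f : ∀ i, CutFree B₁ (Ψ i))
    {hX' : Φ₂ t = .node (!B₂.pol t) X} {k : I} {Θ : B₂.chan → Form O}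
    {hΘ : Θ = upd Φ₂ t (X k)} (g : CutFree B₂ Θ) :
    W.cut (.inp s X hX hΨ f) (.out t X hX' k hΘ g) hc =
      W.cut (f k) g (hc.upd_mid (hs ▸ hΨ k) (ht ▸ hΘ)) := by
  subst hs ht
  rw [cut]
  split
  · exact push_principal hc _ _ (CutFree.principal_out rfl)
  · next hj => simp [W.j₁_cut] at hj

theorem cut_out_inp {s : B₁.chan} {t : B₂.chan} (hs : s = W.c₁) (ht : t = W.c₂)
    {I : Type} [Finite I] {X : I → Form O}
    {hX : Φ₁ s = .node (!B₁.pol s) X} {k : I} {Ψ : B₁.chan → Form O}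
    {hΨ : Ψ = upd Φ₁ s (X k)} (f : CutFree B₁ Ψ)
    {hX' : Φ₂ t = .node (B₂.pol t) X} {Θ : I → B₂.chan → Form O}
    {hΘ : ∀ i, Θ i = upd Φ₂ t (X i)} (g : ∀ i, CutFree B₂ (Θ i)) :
    W.cut (.out s X hX k hΨ f) (.inp t X hX' hΘ g) hc =
      W.cut f (g k) (hc.upd_mid (hs ▸ hΨ) (ht ▸ hΘ k)) := by
  subst hs ht
  rw [cut]
  split
  · exact push_principal hc _ _ (CutFree.principal_inp rfl)
  · next hj => simp [W.j₁_cut] at hj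

end

section
variable {Φ₁ : B₁.chan → Form O} {Φ₂ : B₂.chan → Form O} {Φ : B.chan → Form O}

/-- Inversion for principal cuts: the compound cut formula rules out an axiom, the opposite polarity
rules out an input rule, and injectivity of the constructors identifies the index set and the family
with those of the left rule. -/
theorem exists_eq_out (hc : W.IsCut Φ₁ Φ₂ Φ) {s : B₁.chan} (hs : s = W.c₁) {I : Type} [Finite I]
    {X : I → Form O} (hX : Φ₁ s = .node (B₁.pol s) X)
    (g : CutFree B₂ Φ₂) (hg : g.Principal W.c₂) :
    ∃ (t : B₂.chan) (_ : t = W.c₂) (hX' : Φ₂ t = .node (!B₂.pol t) X) (k : I) (Θ : B₂.chan → Form O)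
      (hΘ : Θ = upd Φ₂ t (X k)) (g' : CutFree B₂ Θ), g = .out t X hX' k hΘ g' := by
  subst hs
  cases g with
  | ax y =>
    obtain ⟨x, hx⟩ := B₂.atomic y W.c₂
    exact (Form.node_ne_atom (hX.symm.trans (hc.mid.trans hx))).elim
  | inp t Y ht =>
    obtain rfl : t = W.c₂ := hg
    rw [W.pol_cut] at ht
    exact (Form.node_ne_node_not (hX.symm.trans (hc.mid.trans ht))).elim
  | out t Y ht k hΘ g =>
    obtain rfl : t = W.c₂ := hg
    have h : Form.node (B₁.pol W.c₁) Y = .node (B₁.pol W.c₁) X := by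
      rw [← hX, hc.mid, ht, W.pol_cut, Bool.not_not]
    obtain ⟨rfl, h⟩ := Form.node_inj h
    obtain rfl := eq_of_heq h
    exact ⟨_, rfl, ht, k, _, hΘ, g, rfl⟩

theorem exists_eq_inp (hc : W.IsCut Φ₁ Φ₂ Φ) {s : B₁.chan} (hs : s = W.c₁) {I : Type} [Finite I]
    {X : I → Form O} (hX : Φ₁ s = .node (!B₁.pol s) X)
    (g : CutFree B₂ Φ₂) (hg : g.Principal W.c₂) :
    ∃ (t : B₂.chan) (_ : t = W.c₂) (hX' : Φ₂ t = .node (B₂.pol t) X) (Θ : I → B₂.chan → Form O)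
      (hΘ : ∀ i, Θ i = upd Φ₂ t (X i)) (g' : ∀ i, CutFree B₂ (Θ i)), g = .inp t X hX' hΘ g' := by
  subst hs
  cases g with
  | ax y =>
    obtain ⟨x, hx⟩ := B₂.atomic y W.c₂
    exact (Form.node_ne_atom (hX.symm.trans (hc.mid.trans hx))).elim
  | out t Y ht =>
    obtain rfl : t = W.c₂ := hg
    rw [W.pol_cut] at ht
    exact (Form.node_ne_node_not (hX.symm.trans (hc.mid.trans ht))).elim
  | inp t Y ht hΘ g =>
    obtain rfl : t = W.c₂ := hg
    have h : Form.node (!B₁.pol W.c₁) Y = .node (!B₁.pol W.c₁) X := by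
      rw [← hX, hc.mid, ht, W.pol_cut]
    obtain ⟨rfl, h⟩ := Form.node_inj h
    obtain rfl := eq_of_heq h
    exact ⟨_, rfl, ht, _, hΘ, g, rfl⟩

theorem exists_eq_ax (hc : W.IsCut Φ₁ Φ₂ Φ) (x : B₁.Ax Φ₁)
    (g : CutFree B₂ Φ₂) (hg : g.Principal W.c₂) : ∃ y, g = .ax y := by
  obtain ⟨x, hx⟩ := B₁.atomic x W.c₁
  cases g with
  | ax y => exact ⟨y, rfl⟩
  | inp t Y ht =>
    obtain rfl : t = W.c₂ := hg
    exact (Form.node_ne_atom (ht.symm.trans (hc.mid.symm.trans hx))).elim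
  | out t Y ht =>
    obtain rfl : t = W.c₂ := hg
    exact (Form.node_ne_atom (ht.symm.trans (hc.mid.symm.trans hx))).elim

/-- A cut commutes with an input rule of the right premise. -/
theorem cut_inp_right (f : CutFree B₁ Φ₁) {Φ₂ : B₂.chan → Form O} {Φ : B.chan → Form O}
    (hc : W.IsCut Φ₁ Φ₂ Φ) {t : B₂.chan} {I : Type} [Finite I] {X : I → Form O}
    {ht : Φ₂ t = .node (B₂.pol t) X} {Ψ : I → B₂.chan → Form O}
    {hΨ : ∀ i, Ψ i = upd Φ₂ t (X i)} (g : ∀ i, CutFree B₂ (Ψ i)) {r : B.chan}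
    (hj : W.j₂ t = some r) {Θ : I → B.chan → Form O} (hΘ : ∀ i, Θ i = upd Φ r (X i)) :
    PermEq (W.cut f (.inp t X ht hΨ g) hc)
      (.inp r X (by rw [hc.right hj, W.pol₂ hj, ht]) hΘ
        fun i => W.cut f (g i) (hc.upd_right hj (hΨ i) (hΘ i))) := by
  induction f generalizing Φ₂ Φ Θ with
  | ax x => rw [cut_principal_inp hc (CutFree.principal_ax x) g hj hΘ]; exact .refl _
  | @inp Φ₁ s J _ Y hs Ψ' hΨ' f ih =>
    cases hs' : W.j₁ s with
    | none => rw [cut_principal_inp hc (CutFree.principal_inp (Wiring.eq_cut₁ hs')) g hj hΘ]; exact .refl _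
    | some r' =>
      have hne : r' ≠ r := fun h => W.disj hs' (h ▸ hj)
      -- Replacements on different channels commute, so both orders of the two rules can be given
      -- the same innermost sequents.
      have hΞ : ∀ i j, upd (upd Φ r' (Y j)) r (X i) = upd (Θ i) r' (Y j) := fun i j => by
        rw [hΘ, upd_comm hne]
      simp only [cut_inp_left hc _ _ hs' (fun _ => rfl)]
      simp only [fun i => cut_inp_left (hc.upd_right hj (hΨ i) (hΘ i)) f (g i) (hs := hs) (hΨ := hΨ') hs' (hΞ i)]
      -- The left rule comes out first; beneath it the induction hypothesis brings out the right
      -- rule, and a permuting conversion exchanges the two.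
      exact (PermEq.inp_congr fun j => ih j _ (fun _ => rfl)).trans
        (.inp_inp hne (hΦts := fun j i => hΞ i j) fun j i => W.cut (f j) (g i) _)
  | @out Φ₁ s J _ Y hs k Ψ' hΨ' f ih =>
    cases hs' : W.j₁ s with
    | none => rw [cut_principal_inp hc (CutFree.principal_out (Wiring.eq_cut₁ hs')) g hj hΘ]; exact .refl _
    | some r' =>
      have hne : r' ≠ r := fun h => W.disj hs' (h ▸ hj)
      have hΞ : ∀ i, upd (upd Φ r' (Y k)) r (X i) = upd (Θ i) r' (Y k) := fun i => by
        rw [hΘ, upd_comm hne]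
      simp only [cut_out_left hc _ _ hs' rfl]
      simp only [fun i => cut_out_left (hc.upd_right hj (hΨ i) (hΘ i)) f (g i) (hs := hs) (hΨ := hΨ') hs' (hΞ i)]
      exact (PermEq.out_congr (ih _ (fun _ => rfl))).trans
        (PermEq.inp_out hne.symm _ fun i => W.cut f (g i) _).symm

/-- A cut commutes with an output rule of the right premise. -/
theorem cut_out_right (f : CutFree B₁ Φ₁) {Φ₂ : B₂.chan → Form O} {Φ : B.chan → Form O}
    (hc : W.IsCut Φ₁ Φ₂ Φ) {t : B₂.chan} {I : Type} [Finite I] {X : I → Form O}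
    {ht : Φ₂ t = .node (!B₂.pol t) X} {i : I} {Ψ : B₂.chan → Form O}
    {hΨ : Ψ = upd Φ₂ t (X i)} (g : CutFree B₂ Ψ) {r : B.chan}
    (hj : W.j₂ t = some r) {Θ : B.chan → Form O} (hΘ : Θ = upd Φ r (X i)) :
    PermEq (W.cut f (.out t X ht i hΨ g) hc)
      (.out r X (by rw [hc.right hj, W.pol₂ hj, ht]) i hΘ
        (W.cut f g (hc.upd_right hj hΨ hΘ))) := by
  induction f generalizing Φ₂ Φ Θ with
  | ax x => rw [cut_principal_out hc (CutFree.principal_ax x) g hj hΘ]; exact .refl _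
  | @inp Φ₁ s J _ Y hs Ψ' hΨ' f ih =>
    cases hs' : W.j₁ s with
    | none => rw [cut_principal_out hc (CutFree.principal_inp (Wiring.eq_cut₁ hs')) g hj hΘ]; exact .refl _
    | some r' =>
      have hne : r' ≠ r := fun h => W.disj hs' (h ▸ hj)
      have hΞ : ∀ j, upd (upd Φ r' (Y j)) r (X i) = upd Θ r' (Y j) := fun j => by
        rw [hΘ, upd_comm hne]
      rw [cut_inp_left hc _ _ hs' (fun _ => rfl), cut_inp_left _ _ _ hs' hΞ]
      exact (PermEq.inp_congr fun j => ih j _ rfl).trans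
        (.inp_out hne _ fun j => W.cut (f j) g _)
  | @out Φ₁ s J _ Y hs k Ψ' hΨ' f ih =>
    cases hs' : W.j₁ s with
    | none => rw [cut_principal_out hc (CutFree.principal_out (Wiring.eq_cut₁ hs')) g hj hΘ]; exact .refl _
    | some r' =>
      have hne : r' ≠ r := fun h => W.disj hs' (h ▸ hj)
      have hΞ : upd (upd Φ r' (Y k)) r (X i) = upd Θ r' (Y k) := by
        rw [hΘ, upd_comm hne]
      rw [cut_out_left hc _ _ hs' rfl, cut_out_left _ _ _ hs' hΞ]
      exact (PermEq.out_congr (ih _ rfl)).trans (.out_out hne _ _ (W.cut f g _))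

/-- Derivations with the same cuts against principal derivations have the same cuts. -/
theorem cut_ext {f f' : CutFree B₁ Φ₁}
    (h : ∀ {Φ₂ Φ} (g : CutFree B₂ Φ₂) (hc : W.IsCut Φ₁ Φ₂ Φ), g.Principal W.c₂ →
      PermEq (W.cut f g hc) (W.cut f' g hc))
    {Φ₂ Φ} (g : CutFree B₂ Φ₂) (hc : W.IsCut Φ₁ Φ₂ Φ) :
    PermEq (W.cut f g hc) (W.cut f' g hc) := by
  induction g generalizing Φ with
  | ax y => exact h _ _ trivial
  | @inp _ t _ _ X ht Ψ hΨ g ih =>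
    cases hj : W.j₂ t with
    | none => exact h _ _ (Wiring.eq_cut₂ hj)
    | some r =>
      -- A rule of `g` off the cut channel comes out of both cuts, so it suffices to compare the
      -- cuts with its premises.
      exact ((cut_inp_right f hc g hj fun _ => rfl).trans (.inp_congr fun i => ih i _)).trans
        (cut_inp_right f' hc g hj fun _ => rfl).symm
  | @out _ t _ _ X ht k Ψ hΨ g ih =>
    cases hj : W.j₂ t with
    | none => exact h _ _ (Wiring.eq_cut₂ hj)
    | some r =>
      exact ((cut_out_right f hc g hj rfl).trans (.out_congr (ih _))).trans
        (cut_out_right f' hc g hj rfl).symm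

end

/-! ### Symmetry of cut elimination and congruence in both premises -/

/-- Cut elimination is symmetric. -/
theorem cut_flip {Φ₁ : B₁.chan → Form O} (f : CutFree B₁ Φ₁) {Φ₂ : B₂.chan → Form O}
    {Φ : B.chan → Form O} (g : CutFree B₂ Φ₂) (hc : W.IsCut Φ₁ Φ₂ Φ) :
    PermEq (W.cut f g hc) (W.flip.cut g f hc.swap) := by
  -- For `f` principal, a side rule of `g` comes out of both cuts as an equation: by `push` in one
  -- order, and as a left rule in the other. Only principal `g` remains to be checked.
  have principal : ∀ {Φ₁ : B₁.chan → Form O} (f : CutFree B₁ Φ₁), f.Principal W.c₁ →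
      (∀ {Φ₂ Φ} (g : CutFree B₂ Φ₂) (hc : W.IsCut Φ₁ Φ₂ Φ), g.Principal W.c₂ →
        PermEq (W.cut f g hc) (W.flip.cut g f hc.swap)) →
      ∀ {Φ₂ Φ} (g : CutFree B₂ Φ₂) (hc : W.IsCut Φ₁ Φ₂ Φ),
        PermEq (W.cut f g hc) (W.flip.cut g f hc.swap) := by
    intro Φ₁ f hf h Φ₂ Φ g hc
    induction g generalizing Φ with
    | ax y => exact h _ _ trivial
    | @inp _ t _ _ X ht Ψ hΨ g ih =>
      cases hj : W.j₂ t with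
      | none => exact h _ _ (Wiring.eq_cut₂ hj)
      | some r =>
        rw [cut_principal_inp hc hf g hj (fun _ => rfl),
          cut_inp_left (W := W.flip) hc.swap g f hj (fun _ => rfl)]
        exact .inp_congr fun i => ih i _
    | @out _ t _ _ X ht k Ψ hΨ g ih =>
      cases hj : W.j₂ t with
      | none => exact h _ _ (Wiring.eq_cut₂ hj)
      | some r =>
        rw [cut_principal_out hc hf g hj rfl, cut_out_left (W := W.flip) hc.swap g f hj rfl]
        exact .out_congr (ih _)
  induction f generalizing Φ₂ Φ with
  | ax x =>
    refine principal _ (CutFree.principal_ax x) (fun g hc hg => ?_) g hc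
    obtain ⟨y, rfl⟩ := exists_eq_ax hc x g hg
    exact .refl _
  | @inp Φ₁ s _ _ X hs Ψ hΨ f ih =>
    cases hj : W.j₁ s with
    | none =>
      refine principal _ (CutFree.principal_inp (Wiring.eq_cut₁ hj)) (fun g hc hg => ?_) g hc
      obtain ⟨t, ht, hX, k, Θ, hΘ, g, rfl⟩ := exists_eq_out hc (Wiring.eq_cut₁ hj) hs g hg
      rw [cut_inp_out _ (Wiring.eq_cut₁ hj) ht,
        cut_out_inp (W := W.flip) _ ht (Wiring.eq_cut₁ hj)]
      exact ih _ _ _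
    | some r =>
      rw [cut_inp_left hc f g hj (fun _ => rfl)]
      -- After the exchange `f` is the right premise, whose rules come out only up to permuting
      -- conversions.
      exact (PermEq.inp_congr fun i => ih i g _).trans
        (cut_inp_right (W := W.flip) g hc.swap f hj fun _ => rfl).symm
  | @out Φ₁ s _ _ X hs k Ψ hΨ f ih =>
    cases hj : W.j₁ s with
    | none =>
      refine principal _ (CutFree.principal_out (Wiring.eq_cut₁ hj)) (fun g hc hg => ?_) g hc
      obtain ⟨t, ht, hX, Θ, hΘ, g, rfl⟩ := exists_eq_inp hc (Wiring.eq_cut₁ hj) hs g hg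
      rw [cut_out_inp _ (Wiring.eq_cut₁ hj) ht,
        cut_inp_out (W := W.flip) _ ht (Wiring.eq_cut₁ hj)]
      exact ih _ _
    | some r =>
      rw [cut_out_left hc f g hj rfl]
      exact (PermEq.out_congr (ih g _)).trans
        (cut_out_right (W := W.flip) g hc.swap f hj rfl).symm

/-- A conversion on side channels survives as the same conversion in the conclusion. If one of its
channels is the cut channel, `cut_ext` reduces to a principal `g`; the principal reduction then
consumes the rule on that channel, and for an exchange of two rules both sides compute to the same
derivation. -/
theorem cut_congr_left {Φ₁ : B₁.chan → Form O} {f f' : CutFree B₁ Φ₁} (h : PermEq f f')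
    {Φ₂ : B₂.chan → Form O} {Φ : B.chan → Form O} (g : CutFree B₂ Φ₂) (hc : W.IsCut Φ₁ Φ₂ Φ) :
    PermEq (W.cut f g hc) (W.cut f' g hc) := by
  induction h generalizing Φ₂ Φ with
  | refl => exact .refl _
  | symm _ ih => exact (ih g hc).symm
  | trans _ _ ih ih' => exact (ih g hc).trans (ih' g hc)
  | @inp_congr Φ₁ s _ _ X hs Ψ hΨ f f' _ ih =>
    cases hj : W.j₁ s with
    | none =>
      refine cut_ext (fun g hc hg => ?_) g hc
      obtain ⟨t, ht, hX, k, Θ, hΘ, g, rfl⟩ := exists_eq_out hc (Wiring.eq_cut₁ hj) hs g hg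
      rw [cut_inp_out _ (Wiring.eq_cut₁ hj) ht, cut_inp_out _ (Wiring.eq_cut₁ hj) ht]
      exact ih _ _ _
    | some r =>
      rw [cut_inp_left hc f g hj (fun _ => rfl), cut_inp_left hc f' g hj (fun _ => rfl)]
      exact .inp_congr fun i => ih i g _
  | @out_congr Φ₁ s _ _ X hs k Ψ hΨ f f' _ ih =>
    cases hj : W.j₁ s with
    | none =>
      refine cut_ext (fun g hc hg => ?_) g hc
      obtain ⟨t, ht, hX, Θ, hΘ, g, rfl⟩ := exists_eq_inp hc (Wiring.eq_cut₁ hj) hs g hg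
      rw [cut_out_inp _ (Wiring.eq_cut₁ hj) ht, cut_out_inp _ (Wiring.eq_cut₁ hj) ht]
      exact ih _ _
    | some r =>
      rw [cut_out_left hc f g hj rfl, cut_out_left hc f' g hj rfl]
      exact .out_congr (ih g _)
  | @inp_inp Φ₁ s t hne I J _ _ X Y hs ht Φs Φt Φst hs' ht' hΦs hΦt hΦst hΦts f =>
    cases hj : W.j₁ s with
    | none =>
      have hs₁ := Wiring.eq_cut₁ hj
      cases hk : W.j₁ t with
      | none => exact (hne (hs₁.trans (Wiring.eq_cut₁ hk).symm)).elim
      | some r =>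
        refine cut_ext (fun g hc hg => ?_) g hc
        obtain ⟨t, ht, hX, k, Θ, hΘ, g, rfl⟩ := exists_eq_out hc hs₁ hs g hg
        rw [cut_inp_out _ hs₁ ht, cut_inp_left _ _ _ hk fun _ => rfl,
          cut_inp_left _ _ _ hk fun _ => rfl]
        simp only [cut_inp_out _ hs₁ ht]
        exact .refl _
    | some r =>
      cases hk : W.j₁ t with
      | none =>
        have hs₁ := Wiring.eq_cut₁ hk
        refine cut_ext (fun g hc hg => ?_) g hc
        obtain ⟨t, ht, hX, k, Θ, hΘ, g, rfl⟩ := exists_eq_out hc hs₁ ht g hg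
        rw [cut_inp_out _ hs₁ ht, cut_inp_left _ _ _ hj fun _ => rfl,
          cut_inp_left _ _ _ hj fun _ => rfl]
        simp only [cut_inp_out _ hs₁ ht]
        exact .refl _
      | some r' =>
        have hne' : r ≠ r' := fun h => hne (W.inj₁ (hj.trans (h ▸ hk.symm)))
        rw [cut_inp_left _ _ _ hj fun _ => rfl, cut_inp_left _ _ _ hk fun _ => rfl]
        simp only [fun i => cut_inp_left (hc.upd_left hj (hΦs i) rfl) (f i) g (hs := ht' i)
            (hΨ := hΦst i) hk fun _ => rfl,
          fun j => cut_inp_left (hc.upd_left hk (hΦt j) rfl) (fun i => f i j) g (hs := hs' j)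
            (hΨ := fun i => hΦts i j) hj fun i => upd_comm hne']
        exact .inp_inp hne' fun i j => W.cut (f i j) g _
  | @inp_out Φ₁ s t hne I J _ _ X Y hs ht k Φs Φt Φst hs' ht' hΦs hΦt hΦst hΦts f =>
    cases hj : W.j₁ s with
    | none =>
      have hs₁ := Wiring.eq_cut₁ hj
      cases hk : W.j₁ t with
      | none => exact (hne (hs₁.trans (Wiring.eq_cut₁ hk).symm)).elim
      | some r =>
        refine cut_ext (fun g hc hg => ?_) g hc
        obtain ⟨t, ht, hX, k, Θ, hΘ, g, rfl⟩ := exists_eq_out hc hs₁ hs g hg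
        rw [cut_inp_out _ hs₁ ht, cut_out_left _ _ _ hk rfl,
          cut_out_left _ _ _ hk rfl, cut_inp_out _ hs₁ ht]
        exact .refl _
    | some r =>
      cases hk : W.j₁ t with
      | none =>
        have hs₁ := Wiring.eq_cut₁ hk
        refine cut_ext (fun g hc hg => ?_) g hc
        obtain ⟨t, ht, hX, Θ, hΘ, g, rfl⟩ := exists_eq_inp hc hs₁ ht g hg
        rw [cut_out_inp _ hs₁ ht, cut_inp_left _ _ _ hj fun _ => rfl,
          cut_inp_left _ _ _ hj fun _ => rfl]
        simp only [cut_out_inp _ hs₁ ht]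
        exact .refl _
      | some r' =>
        have hne' : r ≠ r' := fun h => hne (W.inj₁ (hj.trans (h ▸ hk.symm)))
        rw [cut_inp_left _ _ _ hj fun _ => rfl, cut_out_left _ _ _ hk rfl]
        simp only [fun i => cut_out_left (hc.upd_left hj (hΦs i) rfl) (f i) g (hs := ht' i)
            (hΨ := hΦst i) hk rfl,
          cut_inp_left (hc.upd_left hk hΦt rfl) f g (hs := hs')
            (hΨ := hΦts) hj fun i => upd_comm hne']
        exact .inp_out hne' _ fun i => W.cut (f i) g _
  | @out_out Φ₁ s t hne I J _ _ X Y hs ht i j Φs Φt Φst hs' ht' hΦs hΦt hΦst hΦts f =>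
    cases hj : W.j₁ s with
    | none =>
      have hs₁ := Wiring.eq_cut₁ hj
      cases hk : W.j₁ t with
      | none => exact (hne (hs₁.trans (Wiring.eq_cut₁ hk).symm)).elim
      | some r =>
        refine cut_ext (fun g hc hg => ?_) g hc
        obtain ⟨t, ht, hX, Θ, hΘ, g, rfl⟩ := exists_eq_inp hc hs₁ hs g hg
        rw [cut_out_inp _ hs₁ ht, cut_out_left _ _ _ hk rfl,
          cut_out_left _ _ _ hk rfl, cut_out_inp _ hs₁ ht]
        exact .refl _
    | some r =>
      cases hk : W.j₁ t with
      | none =>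
        have hs₁ := Wiring.eq_cut₁ hk
        refine cut_ext (fun g hc hg => ?_) g hc
        obtain ⟨t, ht, hX, Θ, hΘ, g, rfl⟩ := exists_eq_inp hc hs₁ ht g hg
        rw [cut_out_inp _ hs₁ ht, cut_out_left _ _ _ hj rfl,
          cut_out_left _ _ _ hj rfl, cut_out_inp _ hs₁ ht]
        exact .refl _
      | some r' =>
        have hne' : r ≠ r' := fun h => hne (W.inj₁ (hj.trans (h ▸ hk.symm)))
        rw [cut_out_left _ _ _ hj rfl, cut_out_left _ _ _ hk rfl, cut_out_left _ _ _ hk rfl,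
          cut_out_left _ _ _ hj (upd_comm hne')]
        exact .out_out hne' _ _ (W.cut f g _)

/-- The right premise is handled by exchanging the premises with `cut_flip`, which spares a second
induction on conversions. -/
theorem cut_congr {Φ₁ : B₁.chan → Form O} {f f' : CutFree B₁ Φ₁} (h : PermEq f f')
    {Φ₂ : B₂.chan → Form O} {Φ : B.chan → Form O} {g g' : CutFree B₂ Φ₂} (h' : PermEq g g')
    (hc : W.IsCut Φ₁ Φ₂ Φ) :
    PermEq (W.cut f g hc) (W.cut f' g' hc) :=
  (cut_congr_left h g hc).trans ((cut_flip f' g hc).trans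
    ((cut_congr_left (W := W.flip) h' f' hc.swap).trans (cut_flip f' g' hc).symm))

end Junction

end SigmaPi

namespace SigmaPi
variable {O : Type u}

/-! ### Renaming of channels in cut-free derivations -/

/-- A bijection of channels preserving polarities, with an action on axioms. -/
structure Relabel (B B' : Board.{u, v} O) where
  σ : B.chan ≃ B'.chan
  pol : ∀ s, B'.pol (σ s) = B.pol s
  ax : ∀ {Φ Φ'}, (∀ s, Φ' (σ s) = Φ s) → B.Ax Φ → B'.Ax Φ'

theorem Relabel.upd {B B' : Board.{u, v} O} (R : Relabel B B') {Φ Ψ : B.chan → Form O}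
    {Φ' Ψ' : B'.chan → Form O} {s : B.chan} {X : Form O} (h : ∀ s, Φ' (R.σ s) = Φ s)
    (hΨ : Ψ = upd Φ s X) (hΨ' : Ψ' = upd Φ' (R.σ s) X) (t : B.chan) : Ψ' (R.σ t) = Ψ t := by
  subst hΨ hΨ'
  by_cases ht : t = s
  · subst ht; rw [upd_self, upd_self]
  · rw [upd_of_ne ht, upd_of_ne (R.σ.injective.ne ht), h]

namespace CutFree
variable {B B' : Board.{u, v} O} (R : Relabel B B')

/-- Renaming of channels in cut-free derivations. -/
noncomputable def relabel : ∀ {Φ : B.chan → Form O}, CutFree B Φ →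
    ∀ {Φ' : B'.chan → Form O}, (∀ s, Φ' (R.σ s) = Φ s) → CutFree B' Φ'
  | _, .ax x => fun h => .ax (R.ax h x)
  | _, @CutFree.inp _ _ _ s _ _ X hs _ hΨ f => fun h => .inp (R.σ s) X (by rw [h, R.pol, hs]) (fun _ => rfl)
      fun i => relabel (f i) (R.upd h (hΨ i) rfl)
  | _, @CutFree.out _ _ _ s _ _ X hs k _ hΨ f => fun h => .out (R.σ s) X (by rw [h, R.pol, hs]) k rfl
      (relabel f (R.upd h hΨ rfl))

variable {Φ : B.chan → Form O} {Φ' : B'.chan → Form O} (h : ∀ s, Φ' (R.σ s) = Φ s)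

theorem relabel_inp {s : B.chan} {I : Type} [Finite I] {X : I → Form O}
    {hs : Φ s = .node (B.pol s) X} {Ψ : I → B.chan → Form O}
    {hΨ : ∀ i, Ψ i = upd Φ s (X i)} (f : ∀ i, CutFree B (Ψ i))
    {Θ : I → B'.chan → Form O} (hΘ : ∀ i, Θ i = upd Φ' (R.σ s) (X i)) :
    (CutFree.inp s X hs hΨ f).relabel R h = .inp (R.σ s) X (by rw [h, R.pol, hs]) hΘ
      fun i => (f i).relabel R (R.upd h (hΨ i) (hΘ i)) := by
  obtain rfl : Θ = fun i => upd Φ' (R.σ s) (X i) := funext hΘ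
  rfl

theorem relabel_out {s : B.chan} {I : Type} [Finite I] {X : I → Form O}
    {hs : Φ s = .node (!B.pol s) X} {k : I} {Ψ : B.chan → Form O}
    {hΨ : Ψ = upd Φ s (X k)} (f : CutFree B Ψ)
    {Θ : B'.chan → Form O} (hΘ : Θ = upd Φ' (R.σ s) (X k)) :
    (CutFree.out s X hs k hΨ f).relabel R h = .out (R.σ s) X (by rw [h, R.pol, hs]) k hΘ
      (f.relabel R (R.upd h hΨ hΘ)) := by
  subst hΘ
  rfl

theorem Principal.relabel {f : CutFree B Φ} {c : B.chan} (hf : f.Principal c) :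
    (f.relabel R h).Principal (R.σ c) := by
  cases f with
  | ax x => exact principal_ax _
  | inp s => exact principal_inp (congrArg R.σ hf)
  | out s => exact principal_out (congrArg R.σ hf)

end CutFree

namespace Junction
variable {B₁ B₂ B B₁' B₂' B' : Board.{u, v} O} {W : Junction B₁ B₂ B} {W' : Junction B₁' B₂' B'}
  (R₁ : Relabel B₁ B₁') (R₂ : Relabel B₂ B₂') (R : Relabel B B')

/-- Cut elimination is compatible with renaming. -/
theorem relabel_cut (h₁ : ∀ s, W'.j₁ (R₁.σ s) = (W.j₁ s).map R.σ)
    (h₂ : ∀ s, W'.j₂ (R₂.σ s) = (W.j₂ s).map R.σ)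
    (hax : ∀ {Φ₁ Φ₂ Φ Φ₁' Φ₂' Φ'} (hc : W.IsCut Φ₁ Φ₂ Φ) (hc' : W'.IsCut Φ₁' Φ₂' Φ')
      (hΦ₁ : ∀ s, Φ₁' (R₁.σ s) = Φ₁ s) (hΦ₂ : ∀ s, Φ₂' (R₂.σ s) = Φ₂ s)
      (hΦ : ∀ s, Φ' (R.σ s) = Φ s) (x : B₁.Ax Φ₁) (y : B₂.Ax Φ₂),
      R.ax hΦ (W.axCut hc x y) = W'.axCut hc' (R₁.ax hΦ₁ x) (R₂.ax hΦ₂ y))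
    {Φ₁ Φ₂ Φ Φ₁' Φ₂' Φ'} (hc : W.IsCut Φ₁ Φ₂ Φ) (hc' : W'.IsCut Φ₁' Φ₂' Φ')
    (hΦ₁ : ∀ s, Φ₁' (R₁.σ s) = Φ₁ s) (hΦ₂ : ∀ s, Φ₂' (R₂.σ s) = Φ₂ s)
    (hΦ : ∀ s, Φ' (R.σ s) = Φ s) (f : CutFree B₁ Φ₁) (g : CutFree B₂ Φ₂) :
    (W.cut f g hc).relabel R hΦ = W'.cut (f.relabel R₁ hΦ₁) (g.relabel R₂ hΦ₂) hc' := by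
  -- A cut channel is the only one sent to `none`, so a renaming compatible with the wirings must
  -- match the cut channels.
  have hc₁ : R₁.σ W.c₁ = W'.c₁ := Wiring.eq_cut₁ (by rw [h₁, W.j₁_cut]; rfl)
  have hc₂ : R₂.σ W.c₂ = W'.c₂ := Wiring.eq_cut₂ (by rw [h₂, W.j₂_cut]; rfl)
  have principal : ∀ {Φ₁ Φ₁'} (hΦ₁ : ∀ s, Φ₁' (R₁.σ s) = Φ₁ s) (f : CutFree B₁ Φ₁),
      f.Principal W.c₁ →
      (∀ {Φ₂ Φ Φ₂' Φ'} (hc : W.IsCut Φ₁ Φ₂ Φ) (hc' : W'.IsCut Φ₁' Φ₂' Φ')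
        (hΦ₂ : ∀ s, Φ₂' (R₂.σ s) = Φ₂ s) (hΦ : ∀ s, Φ' (R.σ s) = Φ s) (g : CutFree B₂ Φ₂),
        g.Principal W.c₂ →
        (W.cut f g hc).relabel R hΦ = W'.cut (f.relabel R₁ hΦ₁) (g.relabel R₂ hΦ₂) hc') →
      ∀ {Φ₂ Φ Φ₂' Φ'} (hc : W.IsCut Φ₁ Φ₂ Φ) (hc' : W'.IsCut Φ₁' Φ₂' Φ')
        (hΦ₂ : ∀ s, Φ₂' (R₂.σ s) = Φ₂ s) (hΦ : ∀ s, Φ' (R.σ s) = Φ s) (g : CutFree B₂ Φ₂),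
        (W.cut f g hc).relabel R hΦ = W'.cut (f.relabel R₁ hΦ₁) (g.relabel R₂ hΦ₂) hc' := by
    intro Φ₁ Φ₁' hΦ₁ f hf h Φ₂ Φ Φ₂' Φ' hc hc' hΦ₂ hΦ g
    have hf' : (f.relabel R₁ hΦ₁).Principal W'.c₁ := hc₁ ▸ hf.relabel R₁ hΦ₁
    induction g generalizing Φ Φ₂' Φ' with
    | ax y => exact h _ _ _ _ _ (CutFree.principal_ax y)
    | @inp Φ₂ t _ _ X ht Ψ hΨ g ih =>
      cases hj : W.j₂ t with
      | none => exact h _ _ _ _ _ (CutFree.principal_inp (Wiring.eq_cut₂ hj))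
      | some r =>
        have hj' : W'.j₂ (R₂.σ t) = some (R.σ r) := by rw [h₂, hj]; rfl
        rw [cut_principal_inp hc hf g hj fun _ => rfl,
          CutFree.relabel_inp R hΦ _ fun _ => rfl, CutFree.relabel_inp R₂ hΦ₂ _ fun _ => rfl,
          cut_principal_inp hc' hf' _ hj' fun _ => rfl]
        congr 1
        exact funext fun i => ih i _ _ _ _
    | @out Φ₂ t _ _ X ht k Ψ hΨ g ih =>
      cases hj : W.j₂ t with
      | none => exact h _ _ _ _ _ (CutFree.principal_out (Wiring.eq_cut₂ hj))
      | some r =>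
        have hj' : W'.j₂ (R₂.σ t) = some (R.σ r) := by rw [h₂, hj]; rfl
        rw [cut_principal_out hc hf g hj rfl,
          CutFree.relabel_out R hΦ _ rfl, CutFree.relabel_out R₂ hΦ₂ _ rfl,
          cut_principal_out hc' hf' _ hj' rfl]
        congr 1
        exact ih _ _ _ _
  induction f generalizing Φ₂ Φ Φ₁' Φ₂' Φ' with
  | ax x =>
    refine principal hΦ₁ _ (CutFree.principal_ax x) (fun hc hc' hΦ₂ hΦ g hg => ?_) hc hc' hΦ₂ hΦ g
    obtain ⟨y, rfl⟩ := exists_eq_ax hc x g hg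
    exact congrArg CutFree.ax (hax hc hc' hΦ₁ hΦ₂ hΦ x y)
  | @inp Φ₁ s _ _ X hs Ψ hΨ f ih =>
    cases hj : W.j₁ s with
    | none =>
      have hs₁ := Wiring.eq_cut₁ hj
      refine principal hΦ₁ _ (CutFree.principal_inp hs₁)
        (fun hc hc' hΦ₂ hΦ g hg => ?_) hc hc' hΦ₂ hΦ g
      obtain ⟨t, ht, hX, k, Θ, hΘ, g, rfl⟩ := exists_eq_out hc hs₁ hs g hg
      rw [cut_inp_out _ hs₁ ht, CutFree.relabel_inp R₁ hΦ₁ _ fun _ => rfl,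
        CutFree.relabel_out R₂ hΦ₂ _ rfl,
        cut_inp_out _ ((congrArg R₁.σ hs₁).trans hc₁) ((congrArg R₂.σ ht).trans hc₂)]
      exact ih _ _ _ _ _ _ _
    | some r =>
      have hj' : W'.j₁ (R₁.σ s) = some (R.σ r) := by rw [h₁, hj]; rfl
      rw [cut_inp_left hc f g hj fun _ => rfl,
        CutFree.relabel_inp R hΦ _ fun _ => rfl, CutFree.relabel_inp R₁ hΦ₁ _ fun _ => rfl,
        cut_inp_left hc' _ _ hj' fun _ => rfl]
      congr 1
      exact funext fun i => ih i _ _ _ _ _ _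
  | @out Φ₁ s _ _ X hs k Ψ hΨ f ih =>
    cases hj : W.j₁ s with
    | none =>
      have hs₁ := Wiring.eq_cut₁ hj
      refine principal hΦ₁ _ (CutFree.principal_out hs₁)
        (fun hc hc' hΦ₂ hΦ g hg => ?_) hc hc' hΦ₂ hΦ g
      obtain ⟨t, ht, hX, Θ, hΘ, g, rfl⟩ := exists_eq_inp hc hs₁ hs g hg
      rw [cut_out_inp _ hs₁ ht, CutFree.relabel_out R₁ hΦ₁ _ rfl,
        CutFree.relabel_inp R₂ hΦ₂ _ fun _ => rfl,
        cut_out_inp _ ((congrArg R₁.σ hs₁).trans hc₁) ((congrArg R₂.σ ht).trans hc₂)]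
      exact ih _ _ _ _ _ _
    | some r =>
      have hj' : W'.j₁ (R₁.σ s) = some (R.σ r) := by rw [h₁, hj]; rfl
      rw [cut_out_left hc f g hj rfl,
        CutFree.relabel_out R hΦ _ rfl, CutFree.relabel_out R₁ hΦ₁ _ rfl,
        cut_out_left hc' _ _ hj' rfl]
      congr 1
      exact ih _ _ _ _ _ _

/-- A cut with an axiom that acts on axioms as a renaming is a renaming. -/
theorem cut_eq_relabel (R : Relabel B₁ B) (hj : ∀ {s r}, W.j₁ s = some r → R.σ s = r)
    {Φ₂ : B₂.chan → Form O} (y : B₂.Ax Φ₂)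
    (hax : ∀ {Φ₁ Φ} (hc : W.IsCut Φ₁ Φ₂ Φ) (hΦ : ∀ s, Φ (R.σ s) = Φ₁ s) (x : B₁.Ax Φ₁),
      W.axCut hc x y = R.ax hΦ x)
    {Φ₁ Φ} (hc : W.IsCut Φ₁ Φ₂ Φ) (hΦ : ∀ s, Φ (R.σ s) = Φ₁ s) (f : CutFree B₁ Φ₁) :
    W.cut f (.ax y) hc = f.relabel R hΦ := by
  -- The cut formula is the atom `z`, so every rule of `f` acts on a side channel and comes out
  -- until an axiom is reached.
  obtain ⟨z, hz⟩ := B₂.atomic y W.c₂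
  induction f generalizing Φ with
  | ax x => exact congrArg CutFree.ax (hax hc hΦ x)
  | @inp Φ₁ s _ _ X hs Ψ hΨ f ih =>
    cases hs' : W.j₁ s with
    | none =>
      obtain rfl := Wiring.eq_cut₁ hs'
      exact (Form.node_ne_atom (hs.symm.trans (hc.mid.trans hz))).elim
    | some r =>
      obtain rfl := hj hs'
      rw [cut_inp_left hc f _ hs' fun _ => rfl, CutFree.relabel_inp R hΦ _ fun _ => rfl]
      congr 1
      exact funext fun i => ih i _ _
  | @out Φ₁ s _ _ X hs k Ψ hΨ f ih =>
    cases hs' : W.j₁ s with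
    | none =>
      obtain rfl := Wiring.eq_cut₁ hs'
      exact (Form.node_ne_atom (hs.symm.trans (hc.mid.trans hz))).elim
    | some r =>
      obtain rfl := hj hs'
      rw [cut_out_left hc f _ hs' rfl, CutFree.relabel_out R hΦ _ rfl]
      congr 1
      exact ih _ _

end Junction

end SigmaPi

namespace SigmaPi

/-! ### Boards of a polycategory -/

theorem inForm_eq {O : Type u} {C D : Type} (α : C ⊕ D) {I : Type} [Finite I] (X : I → Form O) :
    inForm α X = .node α.isLeft X := by
  cases α <;> rfl

theorem outForm_eq {O : Type u} {C D : Type} (α : C ⊕ D) {I : Type} [Finite I] (X : I → Form O) :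
    outForm α X = .node (!α.isLeft) X := by
  cases α <;> rfl

theorem repl_eq_upd {O : Type u} {C D : Type} (Φ : Sequent O C D) (α : C ⊕ D) (X : Form O) :
    repl Φ α X = upd Φ α X := by
  funext β
  by_cases h : β = α
  · subst h; simp [repl, upd]
  · rw [repl_of_ne h, upd_of_ne h]

/-- Axioms of a sequent. -/
structure AxHom (A : Polycategory.{u, v}) {C D : Type} (Φ : Sequent A.Obj C D) :
    Type (max u v) where
  [finL : Finite C]
  [finR : Finite D]
  {a : C → A.Obj}
  {b : D → A.Obj}
  ha : ∀ c, Φ (.inl c) = .atom (a c)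
  hb : ∀ d, Φ (.inr d) = .atom (b d)
  hom : A.Hom a b

variable {A : Polycategory.{u, v}}

theorem Polycategory.rename_congr {C D C' D' : Type} [Finite C] [Finite D] [Finite C'] [Finite D']
    {a : C → A.Obj} {b : D → A.Obj} {a' : C' → A.Obj} {b' : D' → A.Obj} {e₁ e₂ : C ≃ C'}
    {k₁ k₂ : D ≃ D'} (he : e₁ = e₂) (hk : k₁ = k₂) {h₁ : ∀ c, a' (e₁ c) = a c}
    {h₁' : ∀ d, b' (k₁ d) = b d} {h₂ : ∀ c, a' (e₂ c) = a c} {h₂' : ∀ d, b' (k₂ d) = b d}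
    (f : A.Hom a b) : A.rename e₁ k₁ h₁ h₁' f = A.rename e₂ k₂ h₂ h₂' f := by
  subst he hk
  rfl

/-- The sequent determines the families of objects, as `atom` is injective. Equality of two axioms
that rename the same morphism thus reduces to equality of bijections, without casts between
poly-hom-sets. -/
theorem AxHom.eq_of_rename {C D C' D' : Type} [Finite C] [Finite D] [Finite C'] [Finite D']
    {Φ : Sequent A.Obj C' D'} {a : C → A.Obj} {b : D → A.Obj} (f : A.Hom a b)
    {x y : AxHom A Φ} {e₁ e₂ : C ≃ C'} {k₁ k₂ : D ≃ D'}
    {h₁ : ∀ c, x.a (e₁ c) = a c} {h₁' : ∀ c, x.b (k₁ c) = b c}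
    {h₂ : ∀ c, y.a (e₂ c) = a c} {h₂' : ∀ c, y.b (k₂ c) = b c}
    (hx : x.hom = A.rename e₁ k₁ h₁ h₁' f) (hy : y.hom = A.rename e₂ k₂ h₂ h₂' f)
    (he : e₁ = e₂) (hk : k₁ = k₂) : x = y := by
  obtain @⟨_, _, a₁, b₁, ha₁, hb₁, x⟩ := x
  obtain @⟨_, _, a₂, b₂, ha₂, hb₂, y⟩ := y
  obtain rfl : a₁ = a₂ := funext fun c => Form.atom.inj ((ha₁ c).symm.trans (ha₂ c))
  obtain rfl : b₁ = b₂ := funext fun c => Form.atom.inj ((hb₁ c).symm.trans (hb₂ c))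
  subst he hk
  obtain rfl : x = y := hx.trans hy.symm
  rfl

/-- The channels `C ⊕ D` of a sequent, with the morphisms of `A` as axioms. -/
abbrev board (A : Polycategory.{u, v}) (C D : Type) : Board.{u, max u v} A.Obj where
  chan := C ⊕ D
  pol := Sum.isLeft
  Ax := AxHom A
  atomic x s := by
    rcases s with c | d
    exacts [⟨_, x.ha c⟩, ⟨_, x.hb d⟩]

/-- Renaming of channels. -/
noncomputable abbrev relabeling {C D C' D' : Type} (e : C ≃ C') (e' : D ≃ D') :
    Relabel (board A C D) (board A C' D') where
  σ := Equiv.sumCongr e e'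
  pol := by rintro (_ | _) <;> rfl
  ax h x :=
    haveI := x.finL
    haveI := x.finR
    haveI := Finite.of_equiv _ e
    haveI := Finite.of_equiv _ e'
    { a := fun c => x.a (e.symm c)
      b := fun d => x.b (e'.symm d)
      ha := fun c => by have := h (.inl (e.symm c)); have := x.ha (e.symm c); simp_all
      hb := fun d => by have := h (.inr (e'.symm d)); have := x.hb (e'.symm d); simp_all
      hom := A.rename e e' (by simp) (by simp) x.hom }

/-- The wiring of the cut rule. -/
abbrev cutWiring (A : Polycategory.{u, v}) {C D : Type} (p : Set C) (q : Set D) :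
    Wiring (board A p (Option q)) (board A (Option ↥pᶜ) ↥qᶜ) (board A C D) where
  c₁ := .inr none
  c₂ := .inl none
  pol_cut := rfl
  j₁ := Sum.elim (fun c => some (.inl c)) fun o => o.map fun d => .inr d
  j₂ := Sum.elim (fun o => o.map fun c => .inl c) fun d => some (.inr d)
  j₁_cut := rfl
  j₂_cut := rfl
  inj₁ := by rintro (_ | _ | _) (_ | _ | _) <;> simp [Subtype.ext_iff]
  inj₂ := by rintro ((_ | _) | _) ((_ | _) | _) <;> simp [Subtype.ext_iff]
  disj := by
    rintro (⟨c, hc⟩ | _ | ⟨c, hc⟩) ((_ | ⟨d, hd⟩) | ⟨d, hd⟩) r h <;> simp at h <;> subst h <;> simp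
    all_goals rintro rfl; contradiction
  pol₁ := by rintro (_ | _ | _) r h <;> simp at h <;> subst h <;> rfl
  pol₂ := by rintro ((_ | _) | _) r h <;> simp at h <;> subst h <;> rfl

theorem cutWiring_left {C D : Type} {p : Set C} {q : Set D} (α : p ⊕ q) :
    (cutWiring A p q).j₁ (Sum.map id some α) = some (Sum.map Subtype.val Subtype.val α) := by
  cases α <;> rfl

theorem cutWiring_right {C D : Type} {p : Set C} {q : Set D} (β : ↥pᶜ ⊕ ↥qᶜ) :
    (cutWiring A p q).j₂ (Sum.map some id β) = some (Sum.map Subtype.val Subtype.val β) := by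
  cases β <;> rfl

theorem exists_of_cutWiring_left {C D : Type} {p : Set C} {q : Set D} {s : p ⊕ Option q} {r : C ⊕ D}
    (h : (cutWiring A p q).j₁ s = some r) :
    ∃ α : p ⊕ q, s = Sum.map id some α ∧ r = Sum.map Subtype.val Subtype.val α := by
  rcases s with c | _ | d
  · exact ⟨.inl c, rfl, (Option.some.inj h).symm⟩
  · simp at h
  · exact ⟨.inr d, rfl, (Option.some.inj h).symm⟩

theorem exists_of_cutWiring_right {C D : Type} {p : Set C} {q : Set D}
    {s : Option ↥pᶜ ⊕ ↥qᶜ} {r : C ⊕ D} (h : (cutWiring A p q).j₂ s = some r) :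
    ∃ β : ↥pᶜ ⊕ ↥qᶜ, s = Sum.map some id β ∧ r = Sum.map Subtype.val Subtype.val β := by
  rcases s with (_ | c) | d
  · simp at h
  · exact ⟨.inl c, rfl, (Option.some.inj h).symm⟩
  · exact ⟨.inr d, rfl, (Option.some.inj h).symm⟩

/-- With `eq_cutLeft` and `eq_cutRight`, this translates between the equations on premises in the
cut rule and the relation `IsCut`. -/
theorem isCut_of_eq {C D : Type} {p : Set C} {q : Set D} {Z : Form A.Obj} {Φ : Sequent A.Obj C D}
    {Ψ₁ : Sequent A.Obj p (Option q)} {Ψ₂ : Sequent A.Obj (Option ↥pᶜ) ↥qᶜ}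
    (h₁ : Ψ₁ = cutLeft p q Z Φ) (h₂ : Ψ₂ = cutRight p q Z Φ) :
    (cutWiring A p q).IsCut Ψ₁ Ψ₂ Φ := by
  subst h₁ h₂
  refine ⟨rfl, fun {s r} h => ?_, fun {s r} h => ?_⟩
  · rcases s with c | _ | d <;> simp at h <;> subst h <;> rfl
  · rcases s with (_ | c) | d <;> simp at h <;> subst h <;> rfl

theorem eq_cutLeft {C D : Type} {p : Set C} {q : Set D} {Z : Form A.Obj} {Φ : Sequent A.Obj C D}
    {Ψ₁ : Sequent A.Obj p (Option q)} {Ψ₂ : Sequent A.Obj (Option ↥pᶜ) ↥qᶜ}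
    (h : (cutWiring A p q).IsCut Ψ₁ Ψ₂ Φ) (hZ : Ψ₁ (.inr none) = Z) : Ψ₁ = cutLeft p q Z Φ := by
  funext s
  rcases s with c | _ | d
  exacts [(h.left (s := .inl c) rfl).symm, hZ, (h.left (s := .inr (some d)) rfl).symm]

theorem eq_cutRight {C D : Type} {p : Set C} {q : Set D} {Z : Form A.Obj} {Φ : Sequent A.Obj C D}
    {Ψ₁ : Sequent A.Obj p (Option q)} {Ψ₂ : Sequent A.Obj (Option ↥pᶜ) ↥qᶜ}
    (h : (cutWiring A p q).IsCut Ψ₁ Ψ₂ Φ) (hZ : Ψ₁ (.inr none) = Z) : Ψ₂ = cutRight p q Z Φ := by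
  funext s
  rcases s with (_ | c) | d
  exacts [h.mid.symm.trans hZ, (h.right (s := .inl (some c)) rfl).symm,
    (h.right (s := .inr d) rfl).symm]

open scoped Classical in
/-- The wiring of the cut rule, with the composition of `A`. -/
noncomputable abbrev cutJunction (A : Polycategory.{u, v}) {C D : Type} (p : Set C) (q : Set D) :
    Junction (board A p (Option q)) (board A (Option ↥pᶜ) ↥qᶜ) (board A C D) where
  toWiring := cutWiring A p q
  axCut {Φ₁ Φ₂ Φ} hc x y :=
    haveI := x.finL
    haveI := x.finR
    haveI := y.finL
    haveI := y.finR
    -- Finiteness of the channels of the conclusion comes from the two axioms: each premise bounds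
    -- its share, and the shares are complementary.
    haveI : Finite q := Finite.of_injective _ (Option.some_injective q)
    haveI : Finite ↥pᶜ := Finite.of_injective _ (Option.some_injective ↥pᶜ)
    haveI := Finite.of_equiv _ (Equiv.Set.sumCompl p)
    haveI := Finite.of_equiv _ (Equiv.Set.sumCompl q)
    { a := fun c => Sum.elim x.a (fun c => y.a (some c)) ((Equiv.Set.sumCompl p).symm c)
      b := fun d => Sum.elim (fun d => x.b (some d)) y.b ((Equiv.Set.sumCompl q).symm d)
      ha := fun c => by
        obtain ⟨c | c, rfl⟩ := (Equiv.Set.sumCompl p).surjective c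
        · rw [Equiv.symm_apply_apply]; exact (hc.left (s := .inl c) rfl).trans (x.ha c)
        · rw [Equiv.symm_apply_apply]; exact (hc.right (s := .inl (some c)) rfl).trans (y.ha _)
      hb := fun d => by
        obtain ⟨d | d, rfl⟩ := (Equiv.Set.sumCompl q).surjective d
        · rw [Equiv.symm_apply_apply]; exact (hc.left (s := .inr (some d)) rfl).trans (x.hb _)
        · rw [Equiv.symm_apply_apply]; exact (hc.right (s := .inr d) rfl).trans (y.hb d)
      hom := A.rename (Equiv.Set.sumCompl p) (Equiv.Set.sumCompl q) (fun _ => by simp)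
        (fun _ => by simp)
        (A.cut (Form.atom.inj ((x.hb none).symm.trans (hc.mid.trans (y.ha none)))) x.hom y.hom) }

/-! ### Normal forms of derivations -/

/-- The normal form of a derivation. -/
noncomputable def Deriv.nf : {C D : Type} → {Φ : Sequent A.Obj C D} → Deriv A Φ →
    CutFree (board A C D) Φ
  | _, _, _, @Deriv.ax _ _ _ _ _ _ _ _ ha hb f => .ax ⟨ha, hb, f⟩
  | _, _, _, @Deriv.inp _ _ _ _ α _ _ X hα _ hΨ f =>
      .inp α X (hα.trans (inForm_eq α X)) (fun i => (hΨ i).trans (repl_eq_upd _ _ _))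
        fun i => (f i).nf
  | _, _, _, @Deriv.out _ _ _ _ α _ _ X hα k _ hΨ f =>
      .out α X (hα.trans (outForm_eq α X)) k (hΨ.trans (repl_eq_upd _ _ _)) f.nf
  | _, _, _, .cut p q _ h₁ h₂ f g => (cutJunction A p q).cut f.nf g.nf (isCut_of_eq h₁ h₂)

/-- Cut-free derivations as derivations. -/
noncomputable def CutFree.toDeriv {C D : Type} : {Φ : Sequent A.Obj C D} →
    CutFree (board A C D) Φ → Deriv A Φ
  | _, .ax x => haveI := x.finL; haveI := x.finR; .ax x.ha x.hb x.hom
  | _, @CutFree.inp _ _ _ α _ _ X hα _ hΨ f =>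
      .inp α X (hα.trans (inForm_eq α X).symm) (fun i => (hΨ i).trans (repl_eq_upd _ _ _).symm)
        fun i => (f i).toDeriv
  | _, @CutFree.out _ _ _ α _ _ X hα k _ hΨ f =>
      .out α X (hα.trans (outForm_eq α X).symm) k (hΨ.trans (repl_eq_upd _ _ _).symm) f.toDeriv

theorem PermEq.toDeriv {C D : Type} {Φ : (board A C D).chan → Form A.Obj}
    {f g : CutFree (board A C D) Φ}
    (h : PermEq f g) : Conv f.toDeriv g.toDeriv := by
  induction h with
  | refl => exact .refl _
  | symm _ ih => exact ih.symm
  | trans _ _ ih ih' => exact ih.trans ih'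
  | inp_congr _ ih => exact .inp_congr ih
  | out_congr _ ih => exact .out_congr ih
  | @inp_inp _ _ _ hne _ _ _ _ _ _ _ _ _ _ _ _ _ _ _ _ hΦts f =>
    exact .inp_inp hne (hΦβα := fun i j => (hΦts i j).trans (repl_eq_upd _ _ _).symm)
      fun i j => (f i j).toDeriv
  | inp_out hne k f => exact .inp_out hne k fun i => (f i).toDeriv
  | out_out hne i j f => exact .out_out hne i j f.toDeriv

open Junction

/-- Cuts of cut-free derivations are equivalent to the result of cut elimination. -/
theorem conv_cut_toDeriv {C D : Type} {p : Set C} {q : Set D} {Z : Form A.Obj}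
    {Φ : Sequent A.Obj C D}
    {Ψ₁ : (board A p (Option q)).chan → Form A.Obj} {Ψ₂ : (board A (Option ↥pᶜ) ↥qᶜ).chan → Form A.Obj}
    (h₁ : Ψ₁ = cutLeft p q Z Φ) (h₂ : Ψ₂ = cutRight p q Z Φ)
    (f : CutFree (board A p (Option q)) Ψ₁) (g : CutFree (board A (Option ↥pᶜ) ↥qᶜ) Ψ₂) :
    Conv (.cut p q Z h₁ h₂ f.toDeriv g.toDeriv)
      ((cutJunction A p q).cut f g (isCut_of_eq h₁ h₂)).toDeriv := by
  -- Each clause in the recursion defining `cut` is matched by a generator of `∼`. This part follows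
  -- `push` through the right premise, using `Conv.cut_inp` and `Conv.cut_out`.
  have principal : ∀ {Ψ₁ : (board A p (Option q)).chan → Form A.Obj} (f : CutFree (board A p (Option q)) Ψ₁),
      f.Principal (.inr none : p ⊕ Option q) →
      (∀ {Z : Form A.Obj} {Φ : Sequent A.Obj C D}
        {Ψ₂ : (board A (Option ↥pᶜ) ↥qᶜ).chan → Form A.Obj} (h₁ : Ψ₁ = cutLeft p q Z Φ) (h₂ : Ψ₂ = cutRight p q Z Φ)
        (g : CutFree (board A (Option ↥pᶜ) ↥qᶜ) Ψ₂), g.Principal (.inl none : Option ↥pᶜ ⊕ ↥qᶜ) →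
        Conv (.cut p q Z h₁ h₂ f.toDeriv g.toDeriv)
          ((cutJunction A p q).cut f g (isCut_of_eq h₁ h₂)).toDeriv) →
      ∀ {Z : Form A.Obj} {Φ : Sequent A.Obj C D}
        {Ψ₂ : (board A (Option ↥pᶜ) ↥qᶜ).chan → Form A.Obj} (h₁ : Ψ₁ = cutLeft p q Z Φ) (h₂ : Ψ₂ = cutRight p q Z Φ)
        (g : CutFree (board A (Option ↥pᶜ) ↥qᶜ) Ψ₂),
        Conv (.cut p q Z h₁ h₂ f.toDeriv g.toDeriv)
          ((cutJunction A p q).cut f g (isCut_of_eq h₁ h₂)).toDeriv := by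
    intro Ψ₁ f hf h Z Φ Ψ₂ h₁ h₂ g
    induction g generalizing Φ with
    | ax y => exact h _ _ _ (CutFree.principal_ax y)
    | @inp Ψ₂ t _ _ X ht Θ hΘ g ih =>
      cases hj : (cutWiring A p q).j₂ t with
      | none => exact h _ _ _ (CutFree.principal_inp (Wiring.eq_cut₂ hj))
      | some r =>
        obtain ⟨β, rfl, rfl⟩ := exists_of_cutWiring_right hj
        have hc : (cutWiring A p q).IsCut Ψ₁ Ψ₂ Φ := isCut_of_eq h₁ h₂
        rw [cut_principal_inp (isCut_of_eq h₁ h₂) hf g hj fun i => rfl]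
        have hc' := fun i => hc.upd_right hj (hΘ i) rfl
        have hZ : Ψ₁ (.inr none) = Z := congrFun h₁ (.inr none)
        exact (Conv.cut_inp β f.toDeriv (fun i => (g i).toDeriv) (hΘ := fun i => (repl_eq_upd _ _ _).symm)
          (k₁ := fun i => eq_cutLeft (hc' i) hZ) (k₂ := fun i => eq_cutRight (hc' i) hZ)).trans
          (.inp_congr fun i => ih i _ _)
    | @out Ψ₂ t _ _ X ht k Θ hΘ g ih =>
      cases hj : (cutWiring A p q).j₂ t with
      | none => exact h _ _ _ (CutFree.principal_out (Wiring.eq_cut₂ hj))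
      | some r =>
        obtain ⟨β, rfl, rfl⟩ := exists_of_cutWiring_right hj
        have hc : (cutWiring A p q).IsCut Ψ₁ Ψ₂ Φ := isCut_of_eq h₁ h₂
        rw [cut_principal_out (isCut_of_eq h₁ h₂) hf g hj rfl]
        have hc' := hc.upd_right hj hΘ rfl
        have hZ : Ψ₁ (.inr none) = Z := congrFun h₁ (.inr none)
        exact (Conv.cut_out β k f.toDeriv g.toDeriv (hΘ := (repl_eq_upd _ _ _).symm)
          (k₁ := eq_cutLeft hc' hZ) (k₂ := eq_cutRight hc' hZ)).trans
          (.out_congr (ih _ _))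
  -- The left premise accounts for the other generators: composites of axioms, rules on side
  -- channels, and principal reductions.
  induction f generalizing Z Φ Ψ₂ with
  | ax x =>
    refine principal _ (CutFree.principal_ax x) (fun h₁ h₂ g hg => ?_) h₁ h₂ g
    obtain ⟨y, rfl⟩ := exists_eq_ax (W := cutJunction A p q) (isCut_of_eq h₁ h₂) x g hg
    rw [cut_ax_ax]
    have := ((cutJunction A p q).axCut (isCut_of_eq h₁ h₂) x y).finL
    have := ((cutJunction A p q).axCut (isCut_of_eq h₁ h₂) x y).finR
    have := x.finL
    have := x.finR
    have := y.finL
    have := y.finR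
    exact .cut_ax _ _ _ _ _
  | @inp Ψ₁ s _ _ X hs Θ hΘ f ih =>
    cases hj : (cutWiring A p q).j₁ s with
    | none =>
      obtain rfl := Wiring.eq_cut₁ hj
      refine principal _ (CutFree.principal_inp rfl) (fun h₁ h₂ g hg => ?_) h₁ h₂ g
      have hc := isCut_of_eq h₁ h₂
      obtain ⟨t, rfl, hX, k, Ξ, hΞ, g, rfl⟩ :=
        exists_eq_out (W := cutJunction A p q) hc rfl hs g hg
      rw [cut_inp_out (W := cutJunction A p q) _ rfl rfl]
      have hc' := hc.upd_mid (hΘ k) hΞ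
      have hZ : Θ k (.inr none) = X k := by rw [hΘ, upd_self]
      exact (Conv.tuple_proj k (k₁ := eq_cutLeft hc' hZ) (k₂ := eq_cutRight hc' hZ) _ _).trans
        (ih _ _ _ _)
    | some r =>
      obtain ⟨α, rfl, rfl⟩ := exists_of_cutWiring_left hj
      have hc : (cutWiring A p q).IsCut Ψ₁ Ψ₂ Φ := isCut_of_eq h₁ h₂
      rw [cut_inp_left (W := cutJunction A p q) (isCut_of_eq h₁ h₂) f g hj fun i => rfl]
      have hc' := fun i => hc.upd_left hj (hΘ i) rfl
      have hZ : Ψ₂ (.inl none) = Z := congrFun h₂ (.inl none)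
      exact (Conv.inp_cut α (fun i => (f i).toDeriv) g.toDeriv
        (hΘ := fun i => (repl_eq_upd _ _ _).symm)
        (k₁ := fun i => eq_cutLeft (hc' i) ((hc' i).mid.trans hZ))
        (k₂ := fun i => eq_cutRight (hc' i) ((hc' i).mid.trans hZ))).trans
          (.inp_congr fun i => ih i _ _ _)
  | @out Ψ₁ s _ _ X hs k Θ hΘ f ih =>
    cases hj : (cutWiring A p q).j₁ s with
    | none =>
      obtain rfl := Wiring.eq_cut₁ hj
      refine principal _ (CutFree.principal_out rfl) (fun h₁ h₂ g hg => ?_) h₁ h₂ g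
      have hc := isCut_of_eq h₁ h₂
      obtain ⟨t, rfl, hX, Ξ, hΞ, g, rfl⟩ :=
        exists_eq_inp (W := cutJunction A p q) hc rfl hs g hg
      rw [cut_out_inp (W := cutJunction A p q) _ rfl rfl]
      have hc' := hc.upd_mid hΘ (hΞ k)
      have hZ : Θ (.inr none) = X k := by rw [hΘ, upd_self]
      exact (Conv.inj_cotuple k (k₁ := eq_cutLeft hc' hZ) (k₂ := eq_cutRight hc' hZ) _ _).trans
        (ih _ _ _)
    | some r =>
      obtain ⟨α, rfl, rfl⟩ := exists_of_cutWiring_left hj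
      have hc : (cutWiring A p q).IsCut Ψ₁ Ψ₂ Φ := isCut_of_eq h₁ h₂
      rw [cut_out_left (W := cutJunction A p q) (isCut_of_eq h₁ h₂) f g hj rfl]
      have hc' := hc.upd_left hj hΘ rfl
      have hZ : Ψ₂ (.inl none) = Z := congrFun h₂ (.inl none)
      exact (Conv.out_cut α k f.toDeriv g.toDeriv (hΘ := (repl_eq_upd _ _ _).symm)
        (k₁ := eq_cutLeft hc' (hc'.mid.trans hZ))
        (k₂ := eq_cutRight hc' (hc'.mid.trans hZ))).trans
          (.out_congr (ih _ _ _))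

/-- Every derivation is equivalent to its normal form. -/
theorem conv_nf {C D : Type} {Φ : Sequent A.Obj C D} (f : Deriv A Φ) : Conv f f.nf.toDeriv := by
  induction f with
  | ax => exact .refl _
  | inp α X hα hΨ f ih => exact .inp_congr ih
  | out α X hα k hΨ f ih => exact .out_congr ih
  | cut p q Z h₁ h₂ f g ihf ihg => exact (Conv.cut_congr ihf ihg).trans (conv_cut_toDeriv h₁ h₂ _ _)

end SigmaPi

/-! ### Invariance of the normal form under `∼` -/

namespace SigmaPi
variable {A : Polycategory.{u, v}}

open Junction

/-- The unit laws rewrite a cut to a renamed derivation, so normal forms must commute with renaming.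
The case of a cut is `relabel_cut`. -/
theorem nf_rename {C D : Type} {Φ : Sequent A.Obj C D} (f : Deriv A Φ) {C' D' : Type}
    {Φ' : Sequent A.Obj C' D'} (e : C ≃ C') (e' : D ≃ D') (h : ∀ x, Φ' (Sum.map e e' x) = Φ x) :
    (f.rename e e' h).nf = f.nf.relabel (relabeling e e') h := by
  induction f generalizing C' D' with
  | ax ha hb f => rfl
  | inp α X hα hΨ f ih =>
    rw [Deriv.rename, Deriv.nf, Deriv.nf,
      CutFree.relabel_inp (relabeling e e') h _ fun i => repl_eq_upd _ _ _]
    congr 1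
    exact funext fun i => ih i _ _ _
  | out α X hα k hΨ f ih =>
    rw [Deriv.rename, Deriv.nf, Deriv.nf,
      CutFree.relabel_out (relabeling e e') h _ (repl_eq_upd _ _ _)]
    congr 1
    exact ih _ _ _
  | @cut C D Φ p q Z Ψ₁ Ψ₂ h₁ h₂ f g ihf ihg =>
    rw [Deriv.rename, Deriv.nf, Deriv.nf, ihf, ihg]
    symm
    apply relabel_cut
    · rintro (c | _ | d) <;> rfl
    · rintro ((_ | c) | d) <;> rfl
    · intro Φ₁ Φ₂ Φ Φ₁' Φ₂' Φ' hc hc' hΦ₁ hΦ₂ hΦ x y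
      have := ((cutJunction A p q).axCut hc x y).finL
      have := ((cutJunction A p q).axCut hc x y).finR
      have := x.finL
      have := x.finR
      have := y.finL
      have := y.finR
      have : Finite q := Finite.of_injective _ (Option.some_injective q)
      have : Finite ↥pᶜ := Finite.of_injective _ (Option.some_injective ↥pᶜ)
      have := Finite.of_equiv _ e
      have := Finite.of_equiv _ e'
      -- By `A.cut_rename`, both composites of axioms are renamings of one cut in `A`; it remains to
      -- compare the bijections.
      refine AxHom.eq_of_rename (A.cut (Form.atom.inj ((x.hb none).symm.trans
        (hc.mid.trans (y.ha none)))) x.hom y.hom) (A.rename_trans _ _ _ _ _ _ _ _ _)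
        ((congrArg _ (A.cut_rename _ _ _ _ _ _ _ _ _ _ _)).trans (A.rename_trans _ _ _ _ _ _ _ _ _))
        ?_ ?_
      · ext (c | c) <;> rfl
      · ext (c | c) <;> rfl

theorem PermEq.of_eq {O : Type u} {B : Board.{u, v} O} {Φ : B.chan → Form O} {f g : CutFree B Φ}
    (h : f = g) : PermEq f g := h ▸ .refl f

/-- The value at `none` is forced, being the only one left. The unit laws prescribe the renaming
only off the cut channel, and this supplies the rest. -/
theorem equiv_option_ext {D D' : Type} {k k' : Option D ≃ D'}
    (h : ∀ d, k (some d) = k' (some d)) : k = k' := by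
  ext (_ | d)
  · obtain ⟨_ | d, hd⟩ := k'.surjective (k none)
    · exact hd.symm
    · exact absurd (k.injective ((h d).trans hd)) (by simp)
  · exact h d

theorem isEmpty_of_unit_equiv_option {C : Type} (u : Unit ≃ Option C) : IsEmpty C :=
  ⟨fun c => by simpa using u.symm.injective (Subsingleton.elim (u.symm (some c)) (u.symm none))⟩

/-- The unit law of `A` is stated with the canonical channels `Option Empty` and `Unit`;
compatibility of cut with renaming transports it to arbitrary names. Only the values of the
bijections off the cut channel are recorded. -/
theorem Polycategory.cut_rename_id {C D C' D' : Type} [Finite C] [Finite D] [Finite C'] [Finite D']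
    {a : C → A.Obj} {b : Option D → A.Obj} {a' : Option C' → A.Obj} {b' : D' → A.Obj} {x : A.Obj}
    (u : Unit ≃ Option C') (w : Unit ≃ D') (hu : ∀ t, a' (u t) = x) (hw : ∀ t, b' (w t) = x)
    (h : b none = a' none) (f : A.Hom a b) :
    ∃ (e : C ≃ C ⊕ C') (k : Option D ≃ D ⊕ D') (he : ∀ c, Sum.elim a (fun c => a' (some c)) (e c) = a c)
      (hk : ∀ d, Sum.elim (fun d => b (some d)) b' (k d) = b d),
      (∀ c, e c = .inl c) ∧ (∀ d, k (some d) = .inl d) ∧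
      A.cut h f (A.rename u w hu hw (A.id x)) = A.rename e k he hk f := by
  have := isEmpty_of_unit_equiv_option u
  obtain rfl : b none = x := by
    rw [h, ← hu ()]
    congr 1
    exact u.symm.injective (Subsingleton.elim _ _)
  -- An identity renaming is inserted so that `A.cut_rename` applies to both factors.
  have hf : f = A.rename (Equiv.refl C) (Equiv.refl D).optionCongr (fun _ => rfl)
      (by simp) f :=
    (A.rename_refl f).symm.trans (A.rename_congr rfl (by simp) f)
  have hid : A.rename u w hu hw (A.id (b none)) =
      A.rename (a := fun _ => b none) (Equiv.equivOfIsEmpty Empty C').optionCongr w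
        (by rintro (_ | c); exacts [h.symm, c.elim]) hw
        (A.rename (C' := Option Empty) (Equiv.ofUnique Unit (Option Empty)) (Equiv.refl Unit)
          (fun _ => rfl) (fun _ => rfl) (A.id (b none))) := by
    rw [A.rename_trans]
    refine A.rename_congr ?_ rfl _
    refine Equiv.ext fun t => ?_
    exact u.symm.injective (Subsingleton.elim _ _)
  have key := A.cut_rename (a' := fun _ : Option Empty => b none) (b' := fun _ : Unit => b none)
    (x := a) (y := b) (x' := a') (y' := b')
    (Equiv.refl C) (Equiv.refl D) (Equiv.equivOfIsEmpty Empty C') w (fun _ => rfl) (by simp)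
    (by rintro (_ | c); exacts [h.symm, c.elim]) hw rfl f
    (A.rename (C' := Option Empty) (Equiv.ofUnique Unit (Option Empty)) (Equiv.refl Unit)
      (fun _ => rfl) (fun _ => rfl) (A.id (b none)))
  replace key := key.trans ((congrArg _ (A.cut_id f)).trans (A.rename_trans _ _ _ _ _ _ _ _ _))
  rw [← hf, ← hid] at key
  exact ⟨_, _, _, _, fun c => rfl, fun d => rfl, key⟩

theorem Polycategory.cut_rename_id_left {C D C' D' : Type} [Finite C] [Finite D] [Finite C']
    [Finite D'] {a : C → A.Obj} {b : Option D → A.Obj} {a' : Option C' → A.Obj} {b' : D' → A.Obj}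
    {x : A.Obj} (u : Unit ≃ C) (w : Unit ≃ Option D) (hu : ∀ t, a (u t) = x)
    (hw : ∀ t, b (w t) = x) (h : b none = a' none) (f : A.Hom a' b') :
    ∃ (e : Option C' ≃ C ⊕ C') (k : D' ≃ D ⊕ D')
      (he : ∀ c, Sum.elim a (fun c => a' (some c)) (e c) = a' c)
      (hk : ∀ d, Sum.elim (fun d => b (some d)) b' (k d) = b' d),
      (∀ c, e (some c) = .inr c) ∧ (∀ d, k d = .inr d) ∧
      A.cut h (A.rename u w hu hw (A.id x)) f = A.rename e k he hk f := by
  have := isEmpty_of_unit_equiv_option w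
  obtain rfl : a' none = x := by
    rw [← h, ← hw ()]
    congr 1
    exact w.symm.injective (Subsingleton.elim _ _)
  have hf : f = A.rename (Equiv.refl C').optionCongr (Equiv.refl D') (by simp) (fun _ => rfl) f :=
    (A.rename_refl f).symm.trans (A.rename_congr (by simp) rfl f)
  have hid : A.rename u w hu hw (A.id (a' none)) =
      A.rename (b := fun _ => a' none) u (Equiv.equivOfIsEmpty Empty D).optionCongr hu
        (by rintro (_ | c); exacts [h, c.elim])
        (A.rename (D' := Option Empty) (Equiv.refl Unit) (Equiv.ofUnique Unit (Option Empty))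
          (fun _ => rfl) (fun _ => rfl) (A.id (a' none))) := by
    rw [A.rename_trans]
    refine A.rename_congr rfl ?_ _
    refine Equiv.ext fun t => ?_
    exact w.symm.injective (Subsingleton.elim _ _)
  have key := A.cut_rename (a := fun _ : Unit => a' none) (b := fun _ : Option Empty => a' none)
    (x := a) (y := b) (x' := a') (y' := b')
    u (Equiv.equivOfIsEmpty Empty D) (Equiv.refl C') (Equiv.refl D') hu
    (by rintro (_ | c); exacts [h, c.elim]) (by simp) (fun _ => rfl) rfl
    (A.rename (D' := Option Empty) (Equiv.refl Unit) (Equiv.ofUnique Unit (Option Empty))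
      (fun _ => rfl) (fun _ => rfl) (A.id (a' none))) f
  replace key := key.trans ((congrArg _ (A.id_cut f)).trans (A.rename_trans _ _ _ _ _ _ _ _ _))
  rw [← hf, ← hid] at key
  exact ⟨_, _, _, _, fun c => rfl, fun d => rfl, key⟩

theorem axCut_id {C D : Type} {p : Set C} {q : Set D} (x : A.Obj)
    {Ψ₂ : Sequent A.Obj (Option ↥pᶜ) ↥qᶜ} [Finite ↥pᶜ] [Finite ↥qᶜ]
    {a : Option ↥pᶜ → A.Obj} {b : ↥qᶜ → A.Obj}
    (ha : ∀ c, Ψ₂ (.inl c) = .atom (a c)) (hb : ∀ d, Ψ₂ (.inr d) = .atom (b d))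
    (u : Unit ≃ Option ↥pᶜ) (w : Unit ≃ ↥qᶜ) (hu : ∀ t, a (u t) = x) (hw : ∀ t, b (w t) = x)
    (e : p ≃ C) (he : ∀ c : p, e c = c) (e' : Option q ≃ D) (he' : ∀ d : q, e' (some d) = d)
    {Ψ₁ : Sequent A.Obj p (Option q)} {Φ : Sequent A.Obj C D}
    (hc : (cutJunction A p q).IsCut Ψ₁ Ψ₂ Φ)
    (hΦ : ∀ s, Φ ((relabeling (A := A) e e').σ s) = Ψ₁ s) (f : AxHom A Ψ₁) :
    (cutJunction A p q).axCut hc f ⟨ha, hb, A.rename u w hu hw (A.id x)⟩ =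
      (relabeling e e').ax hΦ f := by
  have := f.finL
  have := f.finR
  have : Finite q := Finite.of_injective _ (Option.some_injective q)
  have := Finite.of_equiv _ e
  have := Finite.of_equiv _ e'
  obtain ⟨r, k, hr, hk, hr', hk', h⟩ := Polycategory.cut_rename_id u w hu hw
    (Form.atom.inj ((f.hb none).symm.trans (hc.mid.trans (ha none)))) f.hom
  refine AxHom.eq_of_rename f.hom ((congrArg _ h).trans (A.rename_trans _ _ _ _ _ _ _ _ _)) rfl ?_ ?_
  · ext c
    simp [hr', he]
  · refine equiv_option_ext fun d => ?_
    simp [hk', he']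

theorem axCut_id_left {C D : Type} {p : Set C} {q : Set D} (x : A.Obj)
    {Ψ₁ : Sequent A.Obj p (Option q)} [Finite p] [Finite (Option q)]
    {a : p → A.Obj} {b : Option q → A.Obj}
    (ha : ∀ c, Ψ₁ (.inl c) = .atom (a c)) (hb : ∀ d, Ψ₁ (.inr d) = .atom (b d))
    (u : Unit ≃ p) (w : Unit ≃ Option q) (hu : ∀ t, a (u t) = x) (hw : ∀ t, b (w t) = x)
    (e : Option ↥pᶜ ≃ C) (he : ∀ c : ↥pᶜ, e (some c) = c) (e' : ↥qᶜ ≃ D)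
    (he' : ∀ d : ↥qᶜ, e' d = d)
    {Ψ₂ : Sequent A.Obj (Option ↥pᶜ) ↥qᶜ} {Φ : Sequent A.Obj C D}
    (hc : (cutJunction A p q).IsCut Ψ₁ Ψ₂ Φ)
    (hΦ : ∀ s, Φ ((relabeling (A := A) e e').σ s) = Ψ₂ s) (g : AxHom A Ψ₂) :
    (cutJunction A p q).axCut hc ⟨ha, hb, A.rename u w hu hw (A.id x)⟩ g =
      (relabeling e e').ax hΦ g := by
  have := g.finL
  have := g.finR
  have : Finite q := Finite.of_injective _ (Option.some_injective q)
  have : Finite ↥pᶜ := Finite.of_injective _ (Option.some_injective ↥pᶜ)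
  have := Finite.of_equiv _ e
  have := Finite.of_equiv _ e'
  obtain ⟨r, k, hr, hk, hr', hk', h⟩ := Polycategory.cut_rename_id_left u w hu hw
    (Form.atom.inj ((hb none).symm.trans (hc.mid.trans (g.ha none)))) g.hom
  refine AxHom.eq_of_rename g.hom ((congrArg _ h).trans (A.rename_trans _ _ _ _ _ _ _ _ _)) rfl ?_ ?_
  · refine equiv_option_ext fun d => ?_
    simp [hr', he]
  · ext c
    simp [hk', he']

/-- The cut-elimination generators become equalities or commutations of `Junction.cut`, and the
permuting conversions become themselves; congruence under cut is `Junction.cut_congr`. -/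
theorem Conv.nf {C D : Type} {Φ : Sequent A.Obj C D} {f g : Deriv A Φ} (h : Conv f g) :
    PermEq f.nf g.nf := by
  induction h with
  | refl => exact .refl _
  | symm _ ih => exact ih.symm
  | trans _ _ ih ih' => exact ih.trans ih'
  | inp_congr _ ih => exact .inp_congr ih
  | out_congr _ ih => exact .out_congr ih
  | cut_congr _ _ ih ih' => exact Junction.cut_congr ih ih' _
  | cut_ax h ha' hb' f g =>
    refine PermEq.of_eq (congrArg CutFree.ax (AxHom.eq_of_rename (A.cut h f g) rfl rfl rfl rfl))
  | cut_id x u w hu hw e he e' he' hΦ f =>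
    rw [nf_rename, Deriv.nf, Deriv.nf, cut_eq_relabel (relabeling e e')]
    · exact .refl _
    · rintro (c | _ | d) r hr <;> simp at hr <;> subst hr
      · exact congrArg Sum.inl (he c)
      · exact congrArg Sum.inr (he' d)
    · intro Φ₁ Φ hc hΦ y
      exact axCut_id x _ _ u w hu hw e he e' he' hc hΦ y
  | id_cut x u w hu hw e he e' he' hΦ g =>
    rw [nf_rename, Deriv.nf, Deriv.nf]
    -- The identity axiom is the left premise here; exchanging the premises puts it where
    -- `cut_eq_relabel` expects it.
    refine (cut_flip _ _ _).trans ?_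
    rw [cut_eq_relabel (relabeling e e')]
    · exact .refl _
    · rintro ((_ | c) | d) r hr <;> simp [Junction.flip, Wiring.flip] at hr <;> subst hr
      · exact congrArg Sum.inl (he c)
      · exact congrArg Sum.inr (he' d)
    · intro Φ₁ Φ hc hΦ y
      exact axCut_id_left x _ _ u w hu hw e he e' he' hc.flip hΦ y
  | @inp_cut C D Φ p q Z Ψ₁ Ψ₂ h₁ h₂ α I _ X hα₁ Θ₁ hΘ₁ hα Θ hΘ k₁ k₂ f g =>
    rw [Deriv.nf, Deriv.nf, Deriv.nf, cut_inp_left (W := cutJunction A p q) _ _ _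
      (cutWiring_left α) fun i => (hΘ i).trans (repl_eq_upd _ _ _)]
    exact .refl _
  | @cut_inp C D Φ p q Z Ψ₁ Ψ₂ h₁ h₂ α I _ X hα₁ Θ₁ hΘ₁ hα Θ hΘ k₁ k₂ f g =>
    exact cut_inp_right (W := cutJunction A p q) _ _ _
      (cutWiring_right α) fun i => (hΘ i).trans (repl_eq_upd _ _ _)
  | @out_cut C D Φ p q Z Ψ₁ Ψ₂ h₁ h₂ α I _ X hα₁ k Θ₁ hΘ₁ hα Θ hΘ k₁ k₂ f g =>
    rw [Deriv.nf, Deriv.nf, Deriv.nf, cut_out_left (W := cutJunction A p q) _ _ _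
      (cutWiring_left α) (hΘ.trans (repl_eq_upd _ _ _))]
    exact .refl _
  | @cut_out C D Φ p q Z Ψ₁ Ψ₂ h₁ h₂ α I _ X hα₁ k Θ₁ hΘ₁ hα Θ hΘ k₁ k₂ f g =>
    exact cut_out_right (W := cutJunction A p q) _ _ _
      (cutWiring_right α) (hΘ.trans (repl_eq_upd _ _ _))
  | inj_cotuple k f g =>
    rw [Deriv.nf, Deriv.nf, Deriv.nf, cut_out_inp (W := cutJunction A _ _) _ rfl rfl]
    exact .refl _
  | tuple_proj k f g =>
    rw [Deriv.nf, Deriv.nf, Deriv.nf, cut_inp_out (W := cutJunction A _ _) _ rfl rfl]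
    exact .refl _
  | @inp_inp _ _ _ _ _ hne _ _ _ _ _ _ _ _ _ _ _ _ _ _ _ _ hΦβα f =>
    exact .inp_inp hne (hΦts := fun i j => (hΦβα i j).trans (repl_eq_upd _ _ _))
      fun i j => (f i j).nf
  | inp_out hne k f => exact .inp_out hne k fun i => (f i).nf
  | out_out hne i j f => exact .out_out hne i j f.nf

end SigmaPi

/-! ### Output poly-hom-sets and the coequalizer -/

namespace SigmaPi
variable {A : Polycategory.{u, v}}

/-- `Conv` is already an equivalence relation, so the quotient identifies nothing more. -/
theorem exact_conv {C D : Type} {Φ : Sequent A.Obj C D} {f g : Deriv A Φ}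
    (h : (Quot.mk _ f : Hom A Φ) = Quot.mk _ g) : Conv f g :=
  (Equivalence.mk Conv.refl Conv.symm Conv.trans).eqvGen_iff.mp (Quot.eqvGen_exact h)

/-- The element of the one-step sum given by a cut-free derivation ending with an output rule. -/
noncomputable def CutFree.oneStep {C D : Type} {Φ : (board A C D).chan → Form A.Obj} :
    CutFree (board A C D) Φ → Option (OneStep A Φ)
  | .ax _ => none
  | @CutFree.inp _ _ _ _ _ _ _ _ _ _ _ => none
  | @CutFree.out _ _ _ α _ _ X hα k _ hΨ f =>
      some ⟨⟨α, X, hα.trans (outForm_eq α X).symm, k⟩,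
        Quot.mk _ (cast (congrArg (Deriv A) (hΨ.trans (repl_eq_upd _ _ _).symm)) f.toDeriv)⟩

/-- Two elements of the one-step sum are the images of one element of the two-step sum. -/
def OneStep.Rel {C D : Type} {Φ : Sequent A.Obj C D} (t t' : OneStep A Φ) : Prop :=
  ∃ w, twoStepFst A Φ w = t ∧ twoStepSnd A Φ w = t'

theorem IsOutput.ne_inForm {C D : Type} {Φ : Sequent A.Obj C D} (h : IsOutput A Φ) (α : C ⊕ D)
    {I : Type} [Finite I] {X : I → Form A.Obj} : Φ α ≠ .node α.isLeft X := by
  intro hα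
  obtain ⟨x, hx⟩ | ⟨J, _, Y, hY⟩ := h.1 α
  · exact Form.node_ne_atom (hα.symm.trans hx)
  · exact Form.node_ne_node_not (hα.symm.trans (hY.trans (outForm_eq α Y)))

/-- An axiom would make every formula an atom, and an input rule would need a channel with an input
formula; only an output rule is left. -/
theorem IsOutput.exists_eq_out {C D : Type} {Φ : (board A C D).chan → Form A.Obj}
    (h : IsOutput A Φ) (f : CutFree (board A C D) Φ) :
    ∃ (α : C ⊕ D) (I : Type) (_ : Finite I) (X : I → Form A.Obj)
      (hα : Φ α = .node (!α.isLeft) X) (k : I) (Ψ : (board A C D).chan → Form A.Obj)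
      (hΨ : Ψ = upd Φ α (X k)) (f' : CutFree (board A C D) Ψ), f = .out α X hα k hΨ f' := by
  cases f with
  | ax x =>
    obtain ⟨α, I, _, X, hα⟩ := h.2
    obtain ⟨y, hy⟩ := (board A C D).atomic x α
    exact (Form.node_ne_atom ((outForm_eq α X).symm.trans (hα.symm.trans hy))).elim
  | inp α X hα => exact (h.ne_inForm α hα).elim
  | out α X hα k hΨ f => exact ⟨α, _, _, X, hα, k, _, hΨ, f, rfl⟩

/-- The last rule of a derivation ending with an output rule determines its one-step element; this
follows that element along a chain of conversions. -/
theorem PermEq.oneStep {C D : Type} {Φ : (board A C D).chan → Form A.Obj}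
    {f g : CutFree (board A C D) Φ} (h : PermEq f g) (hΦ : IsOutput A Φ) {t t' : OneStep A Φ}
    (ht : f.oneStep = some t) (ht' : g.oneStep = some t') :
    Relation.EqvGen OneStep.Rel t t' := by
  induction h with
  | refl => exact Option.some.inj (ht.symm.trans ht') ▸ .refl _
  | symm _ ih => exact (ih hΦ ht' ht).symm
  | @trans Φ f g h _ _ ih ih' =>
    -- The intermediate derivation must end with an output rule too, which is where the shape of the
    -- sequent enters.
    obtain ⟨α, I, _, X, hα, k, Ψ, hΨ, g, rfl⟩ := hΦ.exists_eq_out g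
    exact (ih hΦ ht rfl).trans _ _ _ (ih' hΦ rfl ht')
  | inp_congr => cases ht
  | @out_congr Φ s I _ X hs k Ψ hΨ f g h ih =>
    obtain rfl := Option.some.inj ht
    obtain rfl := Option.some.inj ht'
    obtain rfl := hΨ.trans (repl_eq_upd Φ s (X k)).symm
    let x : OutputIndex Φ := ⟨s, X, hs.trans (outForm_eq s X).symm, k⟩
    -- The residue need not be an output sequent, so no induction is possible; but the premises have
    -- the same class in its poly-hom-set, so the two one-step elements are equal.
    have hfg : (Quot.mk _ f.toDeriv : Hom A x.residue) = Quot.mk _ g.toDeriv :=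
      Quot.sound h.toDeriv
    have := Relation.EqvGen.refl (r := OneStep.Rel) (⟨x, Quot.mk _ f.toDeriv⟩ : OneStep A Φ)
    exact Eq.subst (motive := fun z => Relation.EqvGen OneStep.Rel
      (⟨x, Quot.mk _ f.toDeriv⟩ : OneStep A Φ) ⟨x, z⟩) hfg this
  | inp_inp => cases ht
  | inp_out => cases ht
  | @out_out Φ r s hne I J _ _ X Y hr hs i j Φs Φt Φst hr' hs' hΦs hΦt hΦst hΦts f =>
    obtain rfl := Option.some.inj ht
    obtain rfl := Option.some.inj ht'
    obtain rfl := hΦs.trans (repl_eq_upd Φ r (X i)).symm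
    obtain rfl := hΦt.trans (repl_eq_upd Φ s (Y j)).symm
    obtain rfl := hΦst.trans (repl_eq_upd _ s (Y j)).symm
    -- The exchanged pair of rules, with the class of the common premise, is the required two-step
    -- element.
    refine .rel _ _ ⟨⟨⟨(⟨r, X, hr.trans (outForm_eq r X).symm, i⟩,
      ⟨s, Y, hs.trans (outForm_eq s Y).symm, j⟩), hne⟩, Quot.mk _ f.toDeriv⟩, rfl, rfl⟩

/-- Normalising keeps a final output rule and replaces its premise by an equivalent one, so the
one-step element is recovered from the normal form. -/
theorem oneStep_nf {C D : Type} {Φ : Sequent A.Obj C D} (x : OutputIndex Φ)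
    (f : Deriv A x.residue) :
    haveI := x.fin
    (Deriv.out x.chan x.X x.eq x.event rfl f).nf.oneStep = some ⟨x, Quot.mk _ f⟩ := by
  have : (Quot.mk _ f : Hom A x.residue) = Quot.mk _ f.nf.toDeriv := Quot.sound (conv_nf f)
  rw [this]
  rfl

theorem twoStep_condition {C D : Type} (Φ : Sequent A.Obj C D) (w : TwoStep A Φ) :
    oneStepMap A Φ (twoStepFst A Φ w) = oneStepMap A Φ (twoStepSnd A Φ w) := by
  obtain ⟨⟨⟨x, y⟩, hne⟩, ⟨f⟩⟩ := w
  have := x.fin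
  have := y.fin
  exact Quot.sound (Conv.out_out (I := x.I) (J := y.I) hne x.event y.event f)

theorem eqvGen_of_oneStepMap_eq {C D : Type} {Φ : Sequent A.Obj C D} (hΦ : IsOutput A Φ)
    {t t' : OneStep A Φ} (h : oneStepMap A Φ t = oneStepMap A Φ t') :
    Relation.EqvGen OneStep.Rel t t' := by
  obtain ⟨x, ⟨f⟩⟩ := t
  obtain ⟨y, ⟨g⟩⟩ := t'
  have := x.fin
  have := y.fin
  exact (exact_conv h).nf.oneStep hΦ (oneStep_nf x f) (oneStep_nf y g)

theorem oneStepMap_surjective {C D : Type} {Φ : Sequent A.Obj C D} (hΦ : IsOutput A Φ) :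
    Function.Surjective (oneStepMap A Φ) := by
  rintro ⟨f⟩
  obtain ⟨α, I, _, X, hα, k, Ψ, hΨ, g, hg⟩ := hΦ.exists_eq_out f.nf
  obtain rfl := hΨ.trans (repl_eq_upd Φ α (X k)).symm
  refine ⟨⟨⟨α, X, hα.trans (outForm_eq α X).symm, k⟩, Quot.mk _ g.toDeriv⟩, ?_⟩
  refine (Quot.sound ((conv_nf f).trans ?_)).symm
  rw [hg]
  exact .refl _

open CategoryTheory CategoryTheory.Limits in
theorem isSoftExtension (A : Polycategory.{u, v}) : IsSoftExtension A := by
  intro C D _ _ Φ hΦ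
  refine ⟨by ext w; exact twoStep_condition Φ w, ⟨Cofork.IsColimit.ofExistsUnique fun s => ?_⟩⟩
  -- A cofork identifies the two images of each two-step element, hence everything in the generated
  -- equivalence.
  have hs : ∀ {t t'}, Relation.EqvGen OneStep.Rel t t' → s.π t = s.π t' := by
    intro t t' h
    induction h with
    | rel _ _ h =>
      obtain ⟨w, rfl, rfl⟩ := h
      exact ConcreteCategory.congr_hom s.condition w
    | refl => rfl
    | symm _ _ _ ih => exact ih.symm
    | trans _ _ _ _ _ ih ih' => exact ih.trans ih'
  have hsurj := oneStepMap_surjective hΦ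
  -- The factorisation evaluates the cofork at a chosen one-step preimage; two preimages are
  -- equivalent, so the choice does not matter, and surjectivity gives uniqueness.
  refine ⟨TypeCat.ofHom fun z => s.π (Function.surjInv hsurj z), ?_, fun m hm => ?_⟩
  · ext t
    exact hs (eqvGen_of_oneStepMap_eq hΦ (Function.surjInv_eq hsurj _))
  · ext z
    obtain ⟨t, rfl⟩ := hsurj z
    exact (ConcreteCategory.congr_hom hm t).trans
      (hs (eqvGen_of_oneStepMap_eq hΦ (Function.surjInv_eq hsurj _))).symm

end SigmaPi

/-- The inclusion `A → ΣΠ_A` of a polycategory into its free completion under finite sums and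
products is soft: it is a semi-soft extension and a soft extension. -/
theorem mainTheorem8 (A : SigmaPi.Polycategory.{u, v}) : SigmaPi.InclusionIsSoft A :=
  ⟨fun _ _ _ _ _ hΦ => SigmaPi.oneStepMap_surjective hΦ, SigmaPi.isSoftExtension A⟩
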